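/- All graphs are finite, simple and undirected. Let $\operatorname{dis}_G(u,v)$ be the shortest path distance, $D(G)$ the diameter, $\mathcal N^i_G(u)=\{w:\operatorname{dis}_G(u,w)=i\}$, and $\mathcal N_G(u)=\mathcal N_G^1(u)$. Let $\operatorname{dis}^{\mathrm R}_G(u,v)$ be the resistance distance, i.e. the effective resistance between $u$ and $v$ when every edge of $G$ is a resistor of one ohm. A graph $G$ is distance-regular if $|\mathcal N^i_G(u)\cap\mathcal N^j_G(v)|=|\mathcal N^i_G(w)\cap\mathcal N^j_G(x)|$ for all $i,j$ whenever $\operatorname{dis}_G(u,v)=\operatorname{dis}_G(w,x)$. For a connected distance-regular graph $G$ with $D=D(G)$, the $k$-hop-neighbor array is $\kappa(G)=(k_1,\dots,k_D)$ with $k_i=|\mathcal N^i_G(u)|$ for any vertex $u$, and the intersection array is $\iota(G)=\{b_0,\dots,b_{D-1};c_1,\dots,c_D\}$ with $b_i=|\mathcal N_G(u)\cap\mathcal N^{i+1}_G(v)|$ and $c_i=|\mathcal N_G(u)\cap\mathcal N^{i-1}_G(v)|$ for any $u,v$ with $\operatorname{dis}_G(u,v)=i$. Let $\operatorname{hash}$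 be an injective function into a color set $\mathcal C$, defined on all the objects (tuples, matrices and finite multisets) to which it is applied below. For a distance $d_G$ on the vertex set $\mathcal V_G$, GD-WL starts with a constant color $\chi^0_G(v)=c_0$ and iterates $$\chi^t_G(v)=\operatorname{hash}\bigl(\{\!\{(d_G(v,u),\chi^{t-1}_G(u)):u\in\mathcal V_G\}\!\}\bigr);$$ SPD-WL is the case $d_G=\operatorname{dis}_G$ and RD-WL the case $d_G=\operatorname{dis}^{\mathrm R}_G$. The algorithm 2-FWL starts, on ordered pairs of vertices, with the hash of the $2\times2$ matrix that records by three distinct colors which entries of the pair are equal, adjacent, or distinct and non-adjacent, and iterates $$\chi^t_G(u,v)=\operatorname{hash}\bigl(\chi^{t-1}_G(u,v),\{\!\{(\chi^{t-1}_G(w,v),\chi^{t-1}_G(u,w)):w\in\mathcal V_G\}\!\}\bigr).$$ An algorithm distinguishes $G$ and $H$ if, for all sufficiently large numbers of iterations, the multisets of the final colors of all vertices (for 2-FWL: of all ordered pairs of vertices) of $G$ and of $H$ are different. **Theorem.** Let $G$ and $H$ be connected distance-regular graphs. Then: 1. SPD-WL distinguishes $G$ and $H$ if and only if $\kappa(G)\ne\kappa(H)$.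 2. RD-WL distinguishes $G$ and $H$ if and only if $\iota(G)\ne\iota(H)$. 3. 2-FWL distinguishes $G$ and $H$ if and only if $\iota(G)\ne\iota(H)$. Consequently, on connected distance-regular graphs RD-WL is strictly more powerful than SPD-WL: it distinguishes every two such graphs that SPD-WL distinguishes, and there are two non-isomorphic connected distance-regular graphs that RD-WL distinguishes and SPD-WL does not. Moreover, RD-WL is as powerful as 2-FWL: for any connected distance-regular graphs $G$ and $H$, RD-WL distinguishes them if and only if 2-FWL does. -/

import Mathlib

open Filter
open scoped ENNReal

namespace WLTest

section Graphs

variable {V : Type*} [Fintype V]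

open Classical in
/-- The `i`-hop neighbours of `u`: the vertices at shortest path distance exactly `i` from `u`. -/
noncomputable def hopNeighbors (G : SimpleGraph V) (i : ℕ) (u : V) : Finset V :=
  Finset.univ.filter fun w => G.edist u w = (i : ℕ∞)

open Classical in
/-- `G` is distance-regular: the number of vertices at distance `i` from `u` and at distance `j`
from `v` depends only on `i`, `j` and the distance between `u` and `v`. -/
def IsDistanceRegular (G : SimpleGraph V) : Prop :=
  ∀ (i j : ℕ) (u v w x : V), G.edist u v = G.edist w x →
    (hopNeighbors G i u ∩ hopNeighbors G j v).card =
      (hopNeighbors G i w ∩ hopNeighbors G j x).card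

open Classical in
/-- `k_i`, the number of `i`-hop neighbours of an arbitrarily chosen vertex. -/
noncomputable def hopCount (G : SimpleGraph V) (i : ℕ) : ℕ :=
  if h : Nonempty V then (hopNeighbors G i (Classical.choice h)).card else 0

/-- The `k`-hop-neighbour array `(k_1, …, k_D)`, where `D` is the diameter. -/
noncomputable def hopArray (G : SimpleGraph V) : List ℕ :=
  (List.range G.diam).map fun i => hopCount G (i + 1)

open Classical in
/-- For an arbitrarily chosen pair `(u, v)` of vertices at distance `d`, the number of
neighbours of `u` that are at distance `j` from `v`. -/
noncomputable def intersectionNumber (G : SimpleGraph V) (d j : ℕ) : ℕ :=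
  if h : ∃ p : V × V, G.edist p.1 p.2 = (d : ℕ∞) then
    (hopNeighbors G 1 h.choose.1 ∩ hopNeighbors G j h.choose.2).card
  else 0

/-- The intersection array `{b_0, …, b_{D-1}; c_1, …, c_D}`, as the pair of the list of the
`b_i` and the list of the `c_i`; here `b_i` counts the neighbours of `u` at distance `i + 1`
from `v` and `c_i` those at distance `i - 1` from `v`, where `u` and `v` are at distance `i`. -/
noncomputable def intersectionArray (G : SimpleGraph V) : List ℕ × List ℕ :=
  ((List.range G.diam).map fun i => intersectionNumber G i (i + 1),
    (List.range G.diam).map fun i => intersectionNumber G (i + 1) i)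

/-- Shortest path distance, infinite between different connected components. -/
noncomputable def spDist (G : SimpleGraph V) (u v : V) : ℝ≥0∞ :=
  ((G.edist u v : ℕ∞) : ℝ≥0∞)

open Classical in
/-- `φ` is an electric potential on `G`, every edge being a resistor of one ohm, when a unit
current enters the network at `u` and leaves it at `v`. By Ohm's law the current from `w` to a
neighbour `x` is `φ w - φ x`; Kirchhoff's current law fixes the net current out of each vertex. -/
def IsUnitCurrentPotential (G : SimpleGraph V) (u v : V) (φ : V → ℝ) : Prop :=
  ∀ w : V, ∑ x ∈ Finset.univ.filter (fun x => G.Adj w x), (φ w - φ x) =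
    (if w = u then 1 else 0) - (if w = v then 1 else 0)

open Classical in
/-- Resistance distance: the effective resistance between `u` and `v`, that is, the potential
difference between them when a unit current flows from `u` to `v`. It is infinite when no such
current can flow, i.e. when `u` and `v` lie in different connected components. -/
noncomputable def resistanceDist (G : SimpleGraph V) (u v : V) : ℝ≥0∞ :=
  if h : ∃ φ : V → ℝ, IsUnitCurrentPotential G u v φ then
    ENNReal.ofReal (h.choose u - h.choose v)
  else ⊤

end Graphs

section Algorithms

/-- The objects to which the algorithms below apply the hash function, for a color set `C`:
multisets of pairs (distance, color), `2 × 2` matrices of colors, and pairs of a color and a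
multiset of pairs of colors. -/
inductive HashInput (C : Type*) where
  | distances (m : Multiset (ℝ≥0∞ × C))
  | initial (A : Matrix (Fin 2) (Fin 2) C)
  | refine (c : C) (m : Multiset (C × C))

variable {C : Type*} {V W : Type*} [Fintype V] [Fintype W]

/-- The color mapping of generalized distance WL with distance `d` after `T` iterations. -/
def gdwlColor (hash : HashInput C → C) (c₀ : C) (d : V → V → ℝ≥0∞) : ℕ → V → C
  | 0, _ => c₀
  | T + 1, v =>
      hash (.distances (Finset.univ.val.map fun u => (d v u, gdwlColor hash c₀ d T u)))

/-- The graph representation: the multiset of all vertex colors after `T` iterations. -/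
def gdwlRepr (hash : HashInput C → C) (c₀ : C) (d : V → V → ℝ≥0∞) (T : ℕ) : Multiset C :=
  Finset.univ.val.map (gdwlColor hash c₀ d T)

/-- SPD-WL distinguishes `G` and `H`: the graph representations differ when the number of
iterations is sufficiently large. -/
def SPDWLDistinguishes (hash : HashInput C → C) (c₀ : C)
    (G : SimpleGraph V) (H : SimpleGraph W) : Prop :=
  ∀ᶠ T : ℕ in atTop, gdwlRepr hash c₀ (spDist G) T ≠ gdwlRepr hash c₀ (spDist H) T

/-- RD-WL distinguishes `G` and `H`: the graph representations differ when the number of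
iterations is sufficiently large. -/
def RDWLDistinguishes (hash : HashInput C → C) (c₀ : C)
    (G : SimpleGraph V) (H : SimpleGraph W) : Prop :=
  ∀ᶠ T : ℕ in atTop,
    gdwlRepr hash c₀ (resistanceDist G) T ≠ gdwlRepr hash c₀ (resistanceDist H) T

open Classical in
/-- The matrix of colors that encodes the isomorphism type of the ordered pair `(u, v)`. -/
noncomputable def pairMatrix (nonedge edge node : C) (G : SimpleGraph V) (u v : V) :
    Matrix (Fin 2) (Fin 2) C :=
  Matrix.of fun i j =>
    if ![u, v] i = ![u, v] j then node
    else if G.Adj (![u, v] i) (![u, v] j) then edge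
    else nonedge

/-- The color mapping on ordered pairs of vertices of 2-FWL after `T` iterations. -/
noncomputable def fwlColor (hash : HashInput C → C) (nonedge edge node : C)
    (G : SimpleGraph V) : ℕ → V → V → C
  | 0, u, v => hash (.initial (pairMatrix nonedge edge node G u v))
  | T + 1, u, v =>
      hash (.refine (fwlColor hash nonedge edge node G T u v)
        (Finset.univ.val.map fun w =>
          (fwlColor hash nonedge edge node G T w v, fwlColor hash nonedge edge node G T u w)))

/-- The graph representation of 2-FWL: the multiset of the colors of all ordered pairs. -/
noncomputable def fwlRepr (hash : HashInput C → C) (nonedge edge node : C)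
    (G : SimpleGraph V) (T : ℕ) : Multiset C :=
  (Finset.univ : Finset (V × V)).val.map fun p =>
    fwlColor hash nonedge edge node G T p.1 p.2

/-- 2-FWL distinguishes `G` and `H`: the graph representations differ when the number of
iterations is sufficiently large. -/
def FWLDistinguishes (hash : HashInput C → C) (nonedge edge node : C)
    (G : SimpleGraph V) (H : SimpleGraph W) : Prop :=
  ∀ᶠ T : ℕ in atTop,
    fwlRepr hash nonedge edge node G T ≠ fwlRepr hash nonedge edge node H T

end Algorithms

end WLTest

/-! In a connected distance-regular graph every vertex sees the same multiset of distances, so a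
GD-WL colour whose distance is a function of shortest path distance stays constant on vertices.
Hence the algorithm separates two graphs exactly when their one-round multisets of distances differ
(`eventually_gdwlRepr_ne_iff`). For shortest paths this multiset records the numbers `k_i`.

For resistance, let a unit current enter at `u` and leave uniformly at all `n` vertices. By
regularity it is radial: the vertices beyond distance `i` absorb a fraction of it, which is shared
equally by the `k_i b_i` edges between spheres `i` and `i + 1`. Subtracting the same flow for `v`
gives resistance as a strictly increasing function of distance (`resistanceDist_eq_radialDrop`).
Sorting the values recovers the distances, their multiplicities `k_i`, the edge currents and so the
`b_i`; then `k_i b_i = k_{i+1} c_{i+1}` gives the `c_i`. Conversely the intersection array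
determines all these quantities.

For 2-FWL, colours determine distances after enough rounds, and one more round reads off the
intersection numbers. Conversely, a three-term recursion computes every count of vertices at
distances `i` and `j` from a pair out of the intersection array (`distCount_eq_of_local`), so every
colour is a function of distance, the same for both graphs.

Strictness is witnessed by the icosahedron and the complete bipartite graph on 6 + 6 vertices minus
a perfect matching: both have hop array (5, 5, 1), but `b_1` is 2 for one and 4 for the other. -/

namespace WLTest

/-! ### Distances in connected graphs -/

section Distance

variable {V : Type*} {G : SimpleGraph V}

theorem edist_eq_coe_iff (hG : G.Connected) {u v : V} {i : ℕ} :
    G.edist u v = (i : ℕ∞) ↔ G.dist u v = i := by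
  rw [← (hG u v).coe_dist_eq_edist, Nat.cast_inj]

theorem edist_eq_edist_iff (hG : G.Connected) {u v w x : V} :
    G.edist u v = G.edist w x ↔ G.dist u v = G.dist w x := by
  rw [← (hG w x).coe_dist_eq_edist, edist_eq_coe_iff hG]

theorem exists_adj_dist_eq (hG : G.Connected) {u v : V} {m : ℕ} (h : G.dist u v = m + 1) :
    ∃ w, G.Adj w v ∧ G.dist u w = m := by
  -- A geodesic is taken from `v`, so that its first step gives the required neighbour of `v`.
  obtain ⟨p, hp⟩ := hG.exists_walk_length_eq_dist v u
  rw [SimpleGraph.dist_comm, h] at hp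
  cases p with
  | nil => simp at hp
  | @cons _ w _ hadj q =>
    refine ⟨w, hadj.symm, ?_⟩
    have h1 := SimpleGraph.dist_le q
    have h2 := hG.dist_triangle (u := u) (v := w) (w := v)
    rw [SimpleGraph.dist_eq_one_iff_adj.2 hadj.symm] at h2
    rw [SimpleGraph.dist_comm] at h1
    simp at hp
    omega

theorem dist_le_succ_of_adj (hG : G.Connected) {u v w : V} (h : G.dist u w = 1) :
    G.dist v w ≤ G.dist v u + 1 := by
  have := hG.dist_triangle (u := v) (v := u) (w := w)
  omega

theorem exists_dist_eq (hG : G.Connected) {i : ℕ} (hi : i ≤ G.diam) :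
    ∃ u v : V, G.dist u v = i := by
  have hV := hG.nonempty
  obtain ⟨u, v, huv⟩ := G.exists_dist_eq_diam
  refine ⟨u, ?_⟩
  induction hi using Nat.decreasingInduction with
  | self => exact ⟨v, huv⟩
  | of_succ k _ ih =>
    obtain ⟨w, hw⟩ := ih
    obtain ⟨x, -, hx⟩ := exists_adj_dist_eq hG hw
    exact ⟨x, hx⟩

end Distance

/-! ### Intersection numbers and their relations -/

section Counting

variable {V W : Type*} [Fintype V] [Fintype W] {G : SimpleGraph V} {H : SimpleGraph W}

/-- The number of vertices at distance `i` from `u` and at distance `j` from `v`. -/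
noncomputable def distCount (G : SimpleGraph V) (i j : ℕ) (u v : V) : ℕ :=
  (Finset.univ.filter fun w => G.dist u w = i ∧ G.dist v w = j).card

theorem mem_hopNeighbors (hG : G.Connected) {i : ℕ} {u w : V} :
    w ∈ hopNeighbors G i u ↔ G.dist u w = i := by
  simp [hopNeighbors, edist_eq_coe_iff hG]

open Classical in
theorem card_hopNeighbors_inter (hG : G.Connected) (i j : ℕ) (u v : V) :
    (hopNeighbors G i u ∩ hopNeighbors G j v).card = distCount G i j u v := by
  unfold distCount
  congr 1
  ext w
  simp [mem_hopNeighbors hG]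

theorem isDistanceRegular_iff (hG : G.Connected) : IsDistanceRegular G ↔
    ∀ (i j : ℕ) (u v w x : V), G.dist u v = G.dist w x →
      distCount G i j u v = distCount G i j w x := by
  simp only [IsDistanceRegular, card_hopNeighbors_inter hG, edist_eq_edist_iff hG]

theorem distCount_pos_iff {i j : ℕ} {u v : V} :
    0 < distCount G i j u v ↔ ∃ w, G.dist u w = i ∧ G.dist v w = j := by
  simp [distCount, Finset.card_pos, Finset.Nonempty]

theorem card_filter_dist_eq (hG : G.Connected) (hR : IsDistanceRegular G) (i : ℕ) (v : V) :
    (Finset.univ.filter fun w => G.dist v w = i).card = hopCount G i := by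
  have hV : Nonempty V := ⟨v⟩
  -- A sphere is its intersection with itself, so regularity applied to pairs at distance zero makes
  -- its size independent of the centre.
  have key : ∀ u : V, (hopNeighbors G i u).card = distCount G i i u u := by
    intro u
    rw [distCount]
    congr 1
    ext w
    simp [mem_hopNeighbors hG]
  rw [hopCount, dif_pos hV, key,
    (isDistanceRegular_iff hG).1 hR i i (Classical.choice hV) (Classical.choice hV) v v (by simp)]
  simp [distCount]

theorem distCount_one_eq (hG : G.Connected) (hR : IsDistanceRegular G) (u v : V) (j : ℕ) :
    distCount G 1 j u v = intersectionNumber G (G.dist u v) j := by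
  have h : ∃ p : V × V, G.edist p.1 p.2 = (G.dist u v : ℕ∞) :=
    ⟨(u, v), (edist_eq_coe_iff hG).2 rfl⟩
  rw [intersectionNumber, dif_pos h, card_hopNeighbors_inter hG]
  exact (isDistanceRegular_iff hG).1 hR 1 j _ _ _ _ ((edist_eq_coe_iff hG).1 h.choose_spec).symm

theorem exists_of_intersectionNumber_ne_zero (hG : G.Connected) {i j : ℕ}
    (h : intersectionNumber G i j ≠ 0) :
    ∃ u v w : V, G.dist u v = i ∧ G.dist u w = 1 ∧ G.dist v w = j := by
  unfold intersectionNumber at h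
  split_ifs at h with hp
  · rw [card_hopNeighbors_inter hG] at h
    obtain ⟨w, hw⟩ := distCount_pos_iff.1 (Nat.pos_of_ne_zero h)
    exact ⟨_, _, w, (edist_eq_coe_iff hG).1 hp.choose_spec, hw⟩
  · exact absurd rfl h

theorem dist_le_diam (hG : G.Connected) (u v : V) : G.dist u v ≤ G.diam :=
  have : Nonempty V := ⟨u⟩
  SimpleGraph.dist_le_diam (SimpleGraph.connected_iff_ediam_ne_top.1 hG)

theorem hopCount_pos_iff (hG : G.Connected) (hR : IsDistanceRegular G) {i : ℕ} :
    0 < hopCount G i ↔ i ≤ G.diam := by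
  have hV := hG.nonempty
  constructor
  · intro h
    rw [← card_filter_dist_eq hG hR i (Classical.choice hV), Finset.card_pos] at h
    obtain ⟨w, hw⟩ := h
    rw [← (Finset.mem_filter.1 hw).2]
    exact dist_le_diam hG _ _
  · intro h
    obtain ⟨u, v, huv⟩ := exists_dist_eq hG h
    rw [← card_filter_dist_eq hG hR i u, Finset.card_pos]
    exact ⟨v, by simpa using huv⟩

theorem exists_dist_eq_from (hG : G.Connected) (hR : IsDistanceRegular G) {i : ℕ}
    (hi : i ≤ G.diam) (u : V) : ∃ v, G.dist u v = i := by
  have h := (hopCount_pos_iff hG hR).2 hi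
  rw [← card_filter_dist_eq hG hR i u, Finset.card_pos] at h
  obtain ⟨w, hw⟩ := h
  exact ⟨w, (Finset.mem_filter.1 hw).2⟩

theorem hopCount_zero (hG : G.Connected) (hR : IsDistanceRegular G) : hopCount G 0 = 1 := by
  have hV := hG.nonempty
  rw [← card_filter_dist_eq hG hR 0 (Classical.choice hV), Finset.card_eq_one]
  refine ⟨Classical.choice hV, ?_⟩
  ext w
  simp [hG.dist_eq_zero_iff, eq_comm]

/-- Positivity detects the diameter: a geodesic of length `i + 1` supplies the outward neighbour.
This is how equality of intersection numbers forces equality of diameters. -/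
theorem intersectionNumber_up_pos_iff (hG : G.Connected) (hR : IsDistanceRegular G) {i : ℕ} :
    0 < intersectionNumber G i (i + 1) ↔ i < G.diam := by
  constructor
  · intro h
    obtain ⟨u, v, w, -, -, hw⟩ := exists_of_intersectionNumber_ne_zero hG h.ne'
    have := dist_le_diam hG v w
    omega
  · intro h
    obtain ⟨u, v, huv⟩ := exists_dist_eq hG (i := i + 1) h
    obtain ⟨w, hadj, hw⟩ := exists_adj_dist_eq hG huv
    rw [← hw, SimpleGraph.dist_comm, ← distCount_one_eq hG hR, distCount_pos_iff]
    exact ⟨v, SimpleGraph.dist_eq_one_iff_adj.2 hadj, by rw [huv, SimpleGraph.dist_comm, hw]⟩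

theorem intersectionNumber_down_pos_iff (hG : G.Connected) (hR : IsDistanceRegular G) {i : ℕ} :
    0 < intersectionNumber G (i + 1) i ↔ i < G.diam := by
  constructor
  · intro h
    obtain ⟨u, v, w, hu, -, -⟩ := exists_of_intersectionNumber_ne_zero hG h.ne'
    have := dist_le_diam hG u v
    omega
  · intro h
    obtain ⟨u, v, huv⟩ := exists_dist_eq hG (i := i + 1) h
    obtain ⟨w, hadj, hw⟩ := exists_adj_dist_eq hG huv
    rw [← huv, SimpleGraph.dist_comm, ← distCount_one_eq hG hR, distCount_pos_iff]
    exact ⟨w, SimpleGraph.dist_eq_one_iff_adj.2 hadj.symm, hw⟩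

/-- Double counting of the adjacent pairs between the spheres of radii `i` and `j` around one
vertex. -/
theorem hopCount_mul_intersectionNumber (hG : G.Connected) (hR : IsDistanceRegular G) (i j : ℕ) :
    hopCount G i * intersectionNumber G i j = hopCount G j * intersectionNumber G j i := by
  classical
  have hV := hG.nonempty
  let v := Classical.choice hV
  rw [← card_filter_dist_eq hG hR i v, ← card_filter_dist_eq hG hR j v]
  refine Finset.card_mul_eq_card_mul (fun x y => G.dist x y = 1) ?_ ?_
  · intro x hx
    rw [Finset.mem_filter] at hx
    rw [← hx.2, SimpleGraph.dist_comm, ← distCount_one_eq hG hR, distCount]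
    congr 1
    ext y
    simp [Finset.mem_bipartiteAbove, and_comm]
  · intro y hy
    rw [Finset.mem_filter] at hy
    rw [← hy.2, SimpleGraph.dist_comm, ← distCount_one_eq hG hR, distCount]
    congr 1
    ext x
    simp [Finset.mem_bipartiteBelow, and_comm, SimpleGraph.adj_comm]

theorem intersectionNumber_eq_zero (hG : G.Connected) {i j : ℕ}
    (h : G.diam < i ∨ i + 1 < j ∨ j + 1 < i) : intersectionNumber G i j = 0 := by
  by_contra hne
  obtain ⟨u, v, w, hu, h1, hw⟩ := exists_of_intersectionNumber_ne_zero hG hne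
  have h2 := dist_le_succ_of_adj hG (v := v) h1
  have h3 := dist_le_succ_of_adj hG (v := v) (u := w) (w := u) (by rw [SimpleGraph.dist_comm, h1])
  have h4 := dist_le_diam hG u v
  rw [SimpleGraph.dist_comm (u := v) (v := u)] at h2 h3
  omega

theorem intersectionNumber_zero_zero (hG : G.Connected) : intersectionNumber G 0 0 = 0 := by
  by_contra hne
  obtain ⟨u, v, w, hu, h1, hw⟩ := exists_of_intersectionNumber_ne_zero hG hne
  rw [hG.dist_eq_zero_iff] at hu hw
  subst hu hw
  simp at h1

/-- An edge changes the distance to `v` by at most one, so these three classes exhaust the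
neighbours of `u`. The degree then fixes the middle number, which the array omits. -/
theorem intersectionNumber_add_add (hG : G.Connected) (hR : IsDistanceRegular G) {d : ℕ}
    (hd : d + 1 ≤ G.diam) :
    intersectionNumber G (d + 1) d + intersectionNumber G (d + 1) (d + 1) +
      intersectionNumber G (d + 1) (d + 2) = intersectionNumber G 0 1 := by
  classical
  obtain ⟨u, v, huv⟩ := exists_dist_eq hG hd
  have h0 := distCount_one_eq hG hR u u 1
  rw [SimpleGraph.dist_self] at h0
  rw [← h0, ← huv, ← distCount_one_eq hG hR, ← distCount_one_eq hG hR, ← distCount_one_eq hG hR]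
  simp only [distCount]
  rw [← Finset.card_union_of_disjoint, ← Finset.card_union_of_disjoint]
  · congr 1
    ext w
    simp only [Finset.mem_union, Finset.mem_filter, Finset.mem_univ, true_and, and_self]
    constructor
    · tauto
    · intro h
      have h2 := dist_le_succ_of_adj hG (v := v) h
      have h3 := dist_le_succ_of_adj hG (v := v) (u := w) (w := u)
        (by rw [SimpleGraph.dist_comm, h])
      rw [SimpleGraph.dist_comm (u := v) (v := u)] at h2 h3
      omega
  all_goals
    rw [Finset.disjoint_left]
    intro w
    simp only [Finset.mem_union, Finset.mem_filter, Finset.mem_univ, true_and]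
    omega

theorem hopArray_eq_iff (hG : G.Connected) (hGR : IsDistanceRegular G) (hH : H.Connected)
    (hHR : IsDistanceRegular H) :
    hopArray G = hopArray H ↔ ∀ i, hopCount G i = hopCount H i := by
  constructor
  · intro h i
    have hD : G.diam = H.diam := by simpa [hopArray] using congrArg List.length h
    rw [hopArray, hopArray, hD, List.map_inj_left] at h
    rcases i with _ | i
    · rw [hopCount_zero hG hGR, hopCount_zero hH hHR]
    · by_cases hi : i < H.diam
      · exact h i (List.mem_range.2 hi)
      · have h1 := mt (hopCount_pos_iff hG hGR (i := i + 1)).1 (by omega)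
        have h2 := mt (hopCount_pos_iff hH hHR (i := i + 1)).1 (by omega)
        omega
  · intro h
    have hD : G.diam = H.diam := by
      apply le_antisymm
      · rw [← hopCount_pos_iff hH hHR, ← h, hopCount_pos_iff hG hGR]
      · rw [← hopCount_pos_iff hG hGR, h, hopCount_pos_iff hH hHR]
    simp [hopArray, hD, h]

theorem diam_eq_of_intersectionNumber_eq (hG : G.Connected) (hGR : IsDistanceRegular G)
    (hH : H.Connected) (hHR : IsDistanceRegular H)
    (h : ∀ i j, intersectionNumber G i j = intersectionNumber H i j) : G.diam = H.diam := by
  apply le_antisymm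
  · rw [← not_lt, ← intersectionNumber_up_pos_iff hG hGR, h, intersectionNumber_up_pos_iff hH hHR]
    exact lt_irrefl _
  · rw [← not_lt, ← intersectionNumber_up_pos_iff hH hHR, ← h, intersectionNumber_up_pos_iff hG hGR]
    exact lt_irrefl _

theorem intersectionArray_eq_iff (hG : G.Connected) (hGR : IsDistanceRegular G) (hH : H.Connected)
    (hHR : IsDistanceRegular H) : intersectionArray G = intersectionArray H ↔
      ∀ i j, intersectionNumber G i j = intersectionNumber H i j := by
  constructor
  · intro h
    have hD : G.diam = H.diam := by
      simpa [intersectionArray] using congrArg (fun p => p.1.length) h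
    rw [intersectionArray, intersectionArray, hD, Prod.mk.injEq, List.map_inj_left,
      List.map_inj_left] at h
    obtain ⟨hb, hc⟩ := h
    simp only [List.mem_range] at hb hc
    have up : ∀ i, intersectionNumber G i (i + 1) = intersectionNumber H i (i + 1) := by
      intro i
      by_cases hi : i < H.diam
      · exact hb i hi
      · have h1 := mt (intersectionNumber_up_pos_iff hG hGR (i := i)).1 (by omega)
        have h2 := mt (intersectionNumber_up_pos_iff hH hHR (i := i)).1 (by omega)
        omega
    have down : ∀ i, intersectionNumber G (i + 1) i = intersectionNumber H (i + 1) i := by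
      intro i
      by_cases hi : i < H.diam
      · exact hc i hi
      · have h1 := mt (intersectionNumber_down_pos_iff hG hGR (i := i)).1 (by omega)
        have h2 := mt (intersectionNumber_down_pos_iff hH hHR (i := i)).1 (by omega)
        omega
    intro i j
    -- Outside the tridiagonal band all numbers vanish. On the diagonal the degree relation leaves
    -- only one unknown.
    by_cases hz : G.diam < i ∨ i + 1 < j ∨ j + 1 < i
    · rw [intersectionNumber_eq_zero hG hz, intersectionNumber_eq_zero hH (hD ▸ hz)]
    · obtain rfl | rfl | rfl : j = i + 1 ∨ i = j + 1 ∨ i = j := by omega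
      · exact up i
      · exact down j
      · rcases i with _ | d
        · rw [intersectionNumber_zero_zero hG, intersectionNumber_zero_zero hH]
        · have h1 := intersectionNumber_add_add hG hGR (d := d) (by omega)
          have h2 := intersectionNumber_add_add hH hHR (d := d) (by omega)
          have := up 0
          have := up (d + 1)
          have := down d
          simp only [zero_add, add_assoc, Nat.reduceAdd] at *
          omega
  · intro h
    simp [intersectionArray, diam_eq_of_intersectionNumber_eq hG hGR hH hHR h, h]

theorem hopCount_eq_of_intersectionNumber_eq (hG : G.Connected) (hGR : IsDistanceRegular G)
    (hH : H.Connected) (hHR : IsDistanceRegular H)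
    (h : ∀ i j, intersectionNumber G i j = intersectionNumber H i j) (i : ℕ) :
    hopCount G i = hopCount H i := by
  have hD := diam_eq_of_intersectionNumber_eq hG hGR hH hHR h
  induction i with
  | zero => rw [hopCount_zero hG hGR, hopCount_zero hH hHR]
  | succ i ih =>
    by_cases hi : i < G.diam
    · have h1 := hopCount_mul_intersectionNumber hG hGR i (i + 1)
      have h2 := hopCount_mul_intersectionNumber hH hHR i (i + 1)
      rw [ih, h, h2, ← h (i + 1) i] at h1
      exact (Nat.eq_of_mul_eq_mul_right ((intersectionNumber_down_pos_iff hG hGR).2 hi) h1).symm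
    · have h1 := mt (hopCount_pos_iff hG hGR (i := i + 1)).1 (by omega)
      have h2 := mt (hopCount_pos_iff hH hHR (i := i + 1)).1 (by omega)
      omega

/-- Groups the sphere around `u` by the distance `m` to `v`. The bound `N` only makes the range of
`m` finite. -/
theorem sum_distCount_mul {q : ℕ → ℕ → ℕ}
    (hq : ∀ u v j, distCount G 1 j u v = q (G.dist u v) j) {N : ℕ} (hN : ∀ u v, G.dist u v < N)
    (i j : ℕ) (u v : V) :
    ∑ m ∈ Finset.range N, distCount G i m u v * q m j =
      ∑ w with G.dist u w = i, distCount G 1 j w v := by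
  classical
  rw [← Finset.sum_fiberwise_of_maps_to (t := Finset.range N) (g := fun w => G.dist v w)
    (fun w _ => Finset.mem_range.2 (hN v w))]
  refine Finset.sum_congr rfl fun m _ => ?_
  rw [Finset.filter_filter, distCount, ← smul_eq_mul, ← Finset.sum_const]
  refine Finset.sum_congr rfl fun w hw => ?_
  rw [hq, SimpleGraph.dist_comm, (Finset.mem_filter.1 hw).2.2]

/-- Both sides count adjacent pairs with one end at distance `i` from `u` and the other at distance
`j` from `v`. -/
theorem sum_distCount_comm (G : SimpleGraph V) (i j : ℕ) (u v : V) :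
    ∑ w with G.dist u w = i, distCount G 1 j w v =
      ∑ w with G.dist v w = j, distCount G 1 i w u := by
  classical
  have h := Finset.sum_card_bipartiteAbove_eq_sum_card_bipartiteBelow
    (s := Finset.univ.filter fun w => G.dist u w = i)
    (t := Finset.univ.filter fun x => G.dist v x = j) (fun w x => G.dist w x = 1)
  simp only [Finset.bipartiteAbove, Finset.bipartiteBelow, Finset.filter_filter] at h
  simp only [distCount, and_comm (a := G.dist _ _ = 1)]
  simp_rw [SimpleGraph.dist_comm (G := G) (u := v)] at h ⊢
  simp_rw [h, SimpleGraph.dist_comm]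

theorem distCount_zero (hG : G.Connected) (j : ℕ) (u v : V) :
    distCount G 0 j u v = if G.dist u v = j then 1 else 0 := by
  split_ifs with h
  · rw [distCount, Finset.card_eq_one]
    refine ⟨u, ?_⟩
    ext w
    simp only [hG.dist_eq_zero_iff, Finset.mem_filter, Finset.mem_univ, true_and,
      Finset.mem_singleton]
    constructor
    · exact fun hw => hw.1.symm
    · rintro rfl
      exact ⟨rfl, by rw [SimpleGraph.dist_comm, h]⟩
  · by_contra hne
    obtain ⟨w, hw, hw'⟩ := distCount_pos_iff.1 (Nat.pos_of_ne_zero hne)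
    rw [hG.dist_eq_zero_iff] at hw
    subst hw
    exact h (by rw [SimpleGraph.dist_comm, hw'])

theorem distCount_swap (G : SimpleGraph V) (i j : ℕ) (u v : V) :
    distCount G i j u v = distCount G j i v u := by
  simp only [distCount, and_comm]

/-- Counting adjacent pairs between two spheres in two ways gives a recursion in `i`, whose only new
term carries the coefficient `q (i + 1) i`. Allowing two graphs with a common table `q` serves the
comparison of colours; taking them equal turns a local check into distance-regularity. -/
theorem distCount_eq_of_local (hG : G.Connected) (hH : H.Connected) {q : ℕ → ℕ → ℕ}
    (hGq : ∀ u v j, distCount G 1 j u v = q (G.dist u v) j)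
    (hHq : ∀ u v j, distCount H 1 j u v = q (H.dist u v) j) {u v : V} {x y : W}
    (h : G.dist u v = H.dist x y) (i : ℕ) : ∀ j, distCount G i j u v = distCount H i j x y := by
  induction i using Nat.strong_induction_on with
  | _ i ih =>
  intro j
  rcases i with _ | i
  · rw [distCount_zero hG, distCount_zero hH, h]
  · let N := G.diam + H.diam + i + 2
    have hGN : ∀ u v, G.dist u v < N := fun u v => by have := dist_le_diam hG u v; omega
    have hHN : ∀ u v, H.dist u v < N := fun u v => by have := dist_le_diam hH u v; omega
    have e1 := sum_distCount_comm G i j u v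
    have e2 := sum_distCount_comm H i j x y
    rw [← sum_distCount_mul hGq hGN, ← sum_distCount_mul hGq hGN] at e1
    rw [← sum_distCount_mul hHq hHN, ← sum_distCount_mul hHq hHN] at e2
    rw [Finset.sum_congr rfl fun m _ => by rw [ih i (by omega) m], e2] at e1
    have hmem : i + 1 ∈ Finset.range N := by simp [N]
    rw [← Finset.add_sum_erase _ _ hmem, ← Finset.add_sum_erase _ _ hmem] at e1
    -- A vertex at distance `m > i + 1` has no neighbour at distance `i`, so the sum stops at `m = i
    -- + 1`.
    have vG : ∀ m, i + 1 < m → distCount G j m v u * q m i = 0 := by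
      intro m hm
      by_contra hne
      have := Nat.pos_of_ne_zero (left_ne_zero_of_mul hne)
      obtain ⟨w, -, hw⟩ := distCount_pos_iff.1 this
      have h1 := right_ne_zero_of_mul hne
      rw [← hw, SimpleGraph.dist_comm, ← hGq] at h1
      obtain ⟨a, ha, ha'⟩ := distCount_pos_iff.1 (Nat.pos_of_ne_zero h1)
      have := dist_le_succ_of_adj hG (v := u) (u := a) (w := w) (by rw [SimpleGraph.dist_comm, ha])
      omega
    have vH : ∀ m, i + 1 < m → distCount H j m y x * q m i = 0 := by
      intro m hm
      by_contra hne
      have := Nat.pos_of_ne_zero (left_ne_zero_of_mul hne)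
      obtain ⟨w, -, hw⟩ := distCount_pos_iff.1 this
      have h1 := right_ne_zero_of_mul hne
      rw [← hw, SimpleGraph.dist_comm, ← hHq] at h1
      obtain ⟨a, ha, ha'⟩ := distCount_pos_iff.1 (Nat.pos_of_ne_zero h1)
      have := dist_le_succ_of_adj hH (v := x) (u := a) (w := w) (by rw [SimpleGraph.dist_comm, ha])
      omega
    have e3 : ∑ m ∈ (Finset.range N).erase (i + 1), distCount G j m v u * q m i =
        ∑ m ∈ (Finset.range N).erase (i + 1), distCount H j m y x * q m i := by
      refine Finset.sum_congr rfl fun m hm => ?_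
      rcases lt_or_gt_of_ne (Finset.ne_of_mem_erase hm) with hlt | hgt
      · rw [distCount_swap G, distCount_swap H, ih m hlt]
      · rw [vG m hgt, vH m hgt]
    rw [e3] at e1
    have e4 := Nat.add_right_cancel e1
    rw [distCount_swap G (i + 1), distCount_swap H (i + 1)]
    -- If the coefficient vanishes, no vertex lies at distance `i + 1`, since a geodesic to it would
    -- supply a neighbour at distance `i`; both counts are then zero.
    rcases Nat.eq_zero_or_pos (q (i + 1) i) with hz | hp
    · have zG : distCount G j (i + 1) v u = 0 := by
        by_contra hne
        obtain ⟨w, -, hw⟩ := distCount_pos_iff.1 (Nat.pos_of_ne_zero hne)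
        obtain ⟨a, ha, ha'⟩ := exists_adj_dist_eq hG hw
        rw [← hw, SimpleGraph.dist_comm, ← hGq] at hz
        exact (distCount_pos_iff.2 ⟨a, SimpleGraph.dist_eq_one_iff_adj.2 ha.symm, ha'⟩).ne' hz
      have zH : distCount H j (i + 1) y x = 0 := by
        by_contra hne
        obtain ⟨w, -, hw⟩ := distCount_pos_iff.1 (Nat.pos_of_ne_zero hne)
        obtain ⟨a, ha, ha'⟩ := exists_adj_dist_eq hH hw
        rw [← hw, SimpleGraph.dist_comm, ← hHq] at hz
        exact (distCount_pos_iff.2 ⟨a, SimpleGraph.dist_eq_one_iff_adj.2 ha.symm, ha'⟩).ne' hz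
      rw [zG, zH]
    · exact (Nat.eq_of_mul_eq_mul_right hp e4).symm

end Counting

theorem spDist_eq {V : Type*} {G : SimpleGraph V} (hG : G.Connected) (u v : V) : spDist G u v = (G.dist u v : ℝ≥0∞) := by
  rw [spDist, (edist_eq_coe_iff hG).2 rfl]
  simp

/-! ### GD-WL when all vertices see the same distances -/

section GeneralizedDistance

variable {C : Type*} {V W : Type*} [Fintype V] [Fintype W]

/-- By induction one colour is shared by all vertices of both graphs, so refinement never starts. -/
theorem gdwlRepr_eq_of_map_eq [Nonempty V] [Nonempty W] (hash : HashInput C → C) (c₀ : C)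
    {d : V → V → ℝ≥0∞} {d' : W → W → ℝ≥0∞}
    (h : ∀ v w, Finset.univ.val.map (d v) = Finset.univ.val.map (d' w)) (T : ℕ) :
    gdwlRepr hash c₀ d T = gdwlRepr hash c₀ d' T := by
  have key : ∃ c, (∀ v, gdwlColor hash c₀ d T v = c) ∧ ∀ w, gdwlColor hash c₀ d' T w = c := by
    induction T with
    | zero => exact ⟨c₀, fun _ => rfl, fun _ => rfl⟩
    | succ T ih =>
      obtain ⟨c, hc, hc'⟩ := ih
      have hv : ∀ v, gdwlColor hash c₀ d (T + 1) v =
          hash (.distances ((Finset.univ.val.map (d v)).map fun r => (r, c))) := by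
        intro v
        simp [gdwlColor, hc]
      have hw : ∀ w, gdwlColor hash c₀ d' (T + 1) w =
          hash (.distances ((Finset.univ.val.map (d' w)).map fun r => (r, c))) := by
        intro w
        simp [gdwlColor, hc']
      let v₀ := Classical.arbitrary V
      let w₀ := Classical.arbitrary W
      exact ⟨gdwlColor hash c₀ d (T + 1) v₀, fun v => by rw [hv, hv, h v w₀, h v₀ w₀],
        fun w => by rw [hw, hv, h v₀ w]⟩
  obtain ⟨c, hc, hc'⟩ := key
  have hcard := congrArg Multiset.card (h (Classical.arbitrary V) (Classical.arbitrary W))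
  simp only [Multiset.card_map, Finset.card_val] at hcard
  rw [gdwlRepr, gdwlRepr, funext hc, funext hc', Multiset.map_const', Multiset.map_const',
    Finset.card_val, Finset.card_val, hcard]

theorem exists_map_eq_of_gdwlRepr_eq [Nonempty V] {hash : HashInput C → C}
    (hash_inj : Function.Injective hash) {c₀ : C} {d : V → V → ℝ≥0∞} {d' : W → W → ℝ≥0∞} {T : ℕ}
    (h : gdwlRepr hash c₀ d (T + 1) = gdwlRepr hash c₀ d' (T + 1)) :
    ∃ v w, Finset.univ.val.map (d v) = Finset.univ.val.map (d' w) := by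
  let v := Classical.arbitrary V
  have hv : gdwlColor hash c₀ d (T + 1) v ∈ gdwlRepr hash c₀ d (T + 1) :=
    Multiset.mem_map_of_mem _ (Finset.mem_univ v)
  rw [h, gdwlRepr, Multiset.mem_map] at hv
  obtain ⟨w, -, hw⟩ := hv
  have := HashInput.distances.inj (hash_inj hw)
  refine ⟨v, w, ?_⟩
  -- Forgetting the colours leaves the multisets of distances.
  simpa using (congrArg (Multiset.map Prod.fst) this).symm

theorem eventually_gdwlRepr_ne_iff [Nonempty V] [Nonempty W] {hash : HashInput C → C}
    (hash_inj : Function.Injective hash) {c₀ : C} {d : V → V → ℝ≥0∞} {d' : W → W → ℝ≥0∞}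
    (h : ∀ v w, Finset.univ.val.map (d v) = Finset.univ.val.map (d' w) →
      ∀ v w, Finset.univ.val.map (d v) = Finset.univ.val.map (d' w)) :
    (∀ᶠ T : ℕ in atTop, gdwlRepr hash c₀ d T ≠ gdwlRepr hash c₀ d' T) ↔
      ¬ ∃ v w, Finset.univ.val.map (d v) = Finset.univ.val.map (d' w) := by
  constructor
  · rintro hne ⟨v, w, hvw⟩
    obtain ⟨T, hT⟩ := hne.exists
    exact hT (gdwlRepr_eq_of_map_eq hash c₀ (h v w hvw) T)
  · intro hne
    filter_upwards [eventually_ge_atTop 1] with T hT heq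
    obtain ⟨T, rfl⟩ := Nat.exists_eq_succ_of_ne_zero (Nat.one_le_iff_ne_zero.1 hT)
    exact hne (exists_map_eq_of_gdwlRepr_eq hash_inj heq)

end GeneralizedDistance

/-! ### SPD-WL and the hop array -/

section ShortestPath

variable {C : Type*} {V W : Type*} [Fintype V] [Fintype W] {G : SimpleGraph V} {H : SimpleGraph W}

/-- Any relabelling `F` of distances that separates `i` from the others keeps the multiplicity. It
is used for the identity, the cast to `ℝ≥0∞` and the resistance. -/
theorem count_map_comp_dist (hG : G.Connected) (hR : IsDistanceRegular G) {α : Type*}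
    [DecidableEq α] {F : ℕ → α} {i : ℕ} (hF : ∀ n ≤ G.diam, F i = F n → i = n) (v : V) :
    (Finset.univ.val.map fun u => F (G.dist v u)).count (F i) = hopCount G i := by
  rw [Multiset.count_map, ← card_filter_dist_eq hG hR i v]
  simp only [Finset.card, Finset.filter_val]
  congr 1
  exact Multiset.filter_congr fun u _ =>
    ⟨fun h => (hF _ (dist_le_diam hG v u) h).symm, fun h => by rw [h]⟩

theorem map_dist_eq (hG : G.Connected) (hGR : IsDistanceRegular G) (hH : H.Connected)
    (hHR : IsDistanceRegular H) (h : ∀ i, hopCount G i = hopCount H i) (v : V) (w : W) :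
    Finset.univ.val.map (G.dist v) = Finset.univ.val.map (H.dist w) := by
  ext i
  have hv := count_map_comp_dist hG hGR (F := id) (i := i) (fun _ _ h => h) v
  have hw := count_map_comp_dist hH hHR (F := id) (i := i) (fun _ _ h => h) w
  exact hv.trans ((h i).trans hw.symm)

theorem spdwlDistinguishes_iff {hash : HashInput C → C} (hash_inj : Function.Injective hash)
    {c₀ : C} (hG : G.Connected) (hGR : IsDistanceRegular G) (hH : H.Connected)
    (hHR : IsDistanceRegular H) :
    SPDWLDistinguishes hash c₀ G H ↔ hopArray G ≠ hopArray H := by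
  classical
  have := hG.nonempty
  have := hH.nonempty
  have back : ∀ v w, Finset.univ.val.map (spDist G v) = Finset.univ.val.map (spDist H w) →
      hopArray G = hopArray H := by
    intro v w h
    rw [hopArray_eq_iff hG hGR hH hHR]
    intro i
    have hF : ∀ n : ℕ, (i : ℝ≥0∞) = (n : ℝ≥0∞) → i = n := fun n hn => Nat.cast_injective hn
    rw [← count_map_comp_dist hG hGR (fun n _ => hF n) v,
      ← count_map_comp_dist hH hHR (fun n _ => hF n) w, ← funext (spDist_eq hG v),
      ← funext (spDist_eq hH w)]
    exact congrArg _ h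
  have forth : hopArray G = hopArray H →
      ∀ v w, Finset.univ.val.map (spDist G v) = Finset.univ.val.map (spDist H w) := by
    intro h v w
    rw [hopArray_eq_iff hG hGR hH hHR] at h
    have := congrArg (Multiset.map (fun n : ℕ => (n : ℝ≥0∞))) (map_dist_eq hG hGR hH hHR h v w)
    rw [funext (spDist_eq hG v), funext (spDist_eq hH w)]
    simpa using this
  rw [SPDWLDistinguishes, eventually_gdwlRepr_ne_iff hash_inj fun v w h => forth (back v w h),
    not_iff_not]
  exact ⟨fun ⟨v, w, h⟩ => back v w h,
    fun h => ⟨_, _, forth h (Classical.arbitrary V) (Classical.arbitrary W)⟩⟩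

end ShortestPath

/-! ### Resistance distance and RD-WL -/

section Resistance

variable {C : Type*} {V W : Type*} [Fintype V] [Fintype W] {G : SimpleGraph V} {H : SimpleGraph W}

/-- Two potentials for the same current differ by an element of the kernel of the Laplacian, which
is constant on a connected graph. -/
theorem IsUnitCurrentPotential.sub_eq_sub (hG : G.Connected) {u v : V} {φ ψ : V → ℝ}
    (hφ : IsUnitCurrentPotential G u v φ) (hψ : IsUnitCurrentPotential G u v ψ) :
    φ u - φ v = ψ u - ψ v := by
  classical
  have h : (G.lapMatrix ℝ).mulVec (φ - ψ) = 0 := by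
    ext w
    have h1 := hφ w
    have h2 := hψ w
    rw [Finset.sum_sub_distrib, Finset.sum_const, nsmul_eq_mul] at h1 h2
    rw [SimpleGraph.lapMatrix_mulVec_apply, SimpleGraph.neighborFinset_eq_filter,
      ← SimpleGraph.card_neighborFinset_eq_degree, SimpleGraph.neighborFinset_eq_filter]
    simp only [Pi.sub_apply, Pi.zero_apply, Finset.sum_sub_distrib]
    have e : (Finset.univ.filter fun x => G.Adj w x) =
      @Finset.filter V (fun x => G.Adj w x) (fun x => Classical.propDecidable _) Finset.univ := by
      congr!
    rw [e]
    linarith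
  have := (SimpleGraph.lapMatrix_mulVec_eq_zero_iff_forall_reachable G).1 h u v (hG u v)
  simp only [Pi.sub_apply] at this
  linarith

theorem resistanceDist_eq (hG : G.Connected) {u v : V} {φ : V → ℝ}
    (hφ : IsUnitCurrentPotential G u v φ) : resistanceDist G u v = ENNReal.ofReal (φ u - φ v) := by
  have h : ∃ φ : V → ℝ, IsUnitCurrentPotential G u v φ := ⟨φ, hφ⟩
  rw [resistanceDist, dif_pos h, h.choose_spec.sub_eq_sub hG hφ]

/-- In a distance-regular graph, the number of vertices at distance more than `i` from a vertex. -/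
noncomputable def tailCount (G : SimpleGraph V) (i : ℕ) : ℝ :=
  Fintype.card V - ∑ j ∈ Finset.range (i + 1), (hopCount G j : ℝ)

theorem tailCount_succ (G : SimpleGraph V) (i : ℕ) :
    tailCount G (i + 1) = tailCount G i - hopCount G (i + 1) := by
  rw [tailCount, tailCount, Finset.sum_range_succ _ (i + 1)]
  ring

theorem tailCount_zero (hG : G.Connected) (hR : IsDistanceRegular G) :
    tailCount G 0 = Fintype.card V - 1 := by
  simp [tailCount, hopCount_zero hG hR]

theorem tailCount_eq_card (hG : G.Connected) (hR : IsDistanceRegular G) (v : V) (i : ℕ) :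
    tailCount G i = (Finset.univ.filter fun w => i < G.dist v w).card := by
  have h := Finset.card_filter_add_card_filter_not (s := Finset.univ) fun w => i < G.dist v w
  have h2 := Finset.card_eq_sum_card_fiberwise (f := G.dist v)
    (s := Finset.univ.filter fun w => ¬ i < G.dist v w) (t := Finset.range (i + 1))
    (fun w hw => by simp at hw ⊢; omega)
  have h3 : ∀ j ∈ Finset.range (i + 1),
      ((Finset.univ.filter fun w => ¬ i < G.dist v w).filter fun w => G.dist v w = j).card =
        hopCount G j := by
    intro j hj
    rw [← card_filter_dist_eq hG hR j v, Finset.filter_filter]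
    congr 1
    ext w
    simp at hj ⊢
    omega
  rw [Finset.sum_congr rfl h3] at h2
  rw [h2, Finset.card_univ] at h
  rw [tailCount, ← h]
  push_cast
  ring

theorem tailCount_pos (hG : G.Connected) (hR : IsDistanceRegular G) {i : ℕ} (hi : i < G.diam) :
    0 < tailCount G i := by
  obtain ⟨u, v, huv⟩ := exists_dist_eq hG hi
  rw [tailCount_eq_card hG hR u, Nat.cast_pos, Finset.card_pos]
  exact ⟨v, by simp; omega⟩

theorem tailCount_eq_zero (hG : G.Connected) (hR : IsDistanceRegular G) {i : ℕ}
    (hi : G.diam ≤ i) : tailCount G i = 0 := by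
  have hV := hG.nonempty
  rw [tailCount_eq_card hG hR (Classical.choice hV), Nat.cast_eq_zero, Finset.card_eq_zero,
    Finset.filter_eq_empty_iff]
  intro w _
  have := dist_le_diam hG (Classical.choice hV) w
  omega

/-- The current along an edge joining distances `i` and `i + 1` from `u` when a unit current
enters a distance-regular graph at `u` and leaves it uniformly at all vertices. -/
noncomputable def radialCurrent (G : SimpleGraph V) (i : ℕ) : ℝ :=
  tailCount G i / (Fintype.card V * (hopCount G i * intersectionNumber G i (i + 1) : ℕ))

/-- The current leaving one vertex of sphere `i` outwards. No bound on `i` is needed: from the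
diameter on, nothing lies beyond and both sides vanish. -/
theorem up_mul_radialCurrent (hG : G.Connected) (hR : IsDistanceRegular G) (i : ℕ) :
    intersectionNumber G i (i + 1) * radialCurrent G i =
      tailCount G i / (Fintype.card V * hopCount G i) := by
  by_cases hi : i < G.diam
  · have := (intersectionNumber_up_pos_iff hG hR).2 hi
    have := (hopCount_pos_iff hG hR).2 hi.le
    have : 0 < Fintype.card V := Fintype.card_pos_iff.2 hG.nonempty
    rw [radialCurrent]
    push_cast
    field_simp
  · simp [radialCurrent, tailCount_eq_zero hG hR (not_lt.1 hi)]

theorem down_mul_radialCurrent (hG : G.Connected) (hR : IsDistanceRegular G) {i : ℕ}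
    (hi : i < G.diam) : intersectionNumber G (i + 1) i * radialCurrent G i =
      tailCount G i / (Fintype.card V * hopCount G (i + 1)) := by
  have := (intersectionNumber_down_pos_iff hG hR).2 hi
  have := (hopCount_pos_iff hG hR (i := i + 1)).2 hi
  have : 0 < Fintype.card V := Fintype.card_pos_iff.2 hG.nonempty
  rw [radialCurrent, hopCount_mul_intersectionNumber hG hR]
  push_cast
  field_simp

theorem radialCurrent_pos (hG : G.Connected) (hR : IsDistanceRegular G) {i : ℕ}
    (hi : i < G.diam) : 0 < radialCurrent G i := by
  have := tailCount_pos hG hR hi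
  have := (intersectionNumber_up_pos_iff hG hR).2 hi
  have := (hopCount_pos_iff hG hR).2 hi.le
  have : 0 < Fintype.card V := Fintype.card_pos_iff.2 hG.nonempty
  rw [radialCurrent]
  positivity

/-- The drop of potential over distance `i` from the source of a radial current. -/
noncomputable def radialDrop (G : SimpleGraph V) (i : ℕ) : ℝ :=
  ∑ j ∈ Finset.range i, radialCurrent G j

theorem radialDrop_succ (G : SimpleGraph V) (i : ℕ) :
    radialDrop G (i + 1) = radialDrop G i + radialCurrent G i :=
  Finset.sum_range_succ _ _

open Classical in
-- Kirchhoff's law for the radial flow: away from `u`, inflow and outflow at a vertex of sphere `i`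
-- differ by `k_i / (n k_i) = 1 / n`; at `u`, the outflow is `(n - 1) / n`.
theorem sum_radialDrop_sub (hG : G.Connected) (hR : IsDistanceRegular G) (u w : V) :
    ∑ x with G.Adj w x, (radialDrop G (G.dist u x) - radialDrop G (G.dist u w)) =
      (if w = u then 1 else 0) - 1 / Fintype.card V := by
  have hn : (0 : ℝ) < Fintype.card V := Nat.cast_pos.2 (Fintype.card_pos_iff.2 hG.nonempty)
  -- Neighbours in the same sphere carry no current. The truncated subtraction is harmless, as its
  -- branch requires a positive distance.
  have hterm : ∀ x ∈ Finset.univ.filter (fun x => G.Adj w x),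
      radialDrop G (G.dist u x) - radialDrop G (G.dist u w) =
        (if G.dist u x = G.dist u w + 1 then radialCurrent G (G.dist u w) else 0) -
          (if G.dist u x + 1 = G.dist u w then radialCurrent G (G.dist u w - 1) else 0) := by
    intro x hx
    have hadj := SimpleGraph.dist_eq_one_iff_adj.2 (Finset.mem_filter.1 hx).2
    have h1 := dist_le_succ_of_adj hG (v := u) hadj
    have h2 := dist_le_succ_of_adj hG (v := u) (u := x) (w := w)
      (by rw [SimpleGraph.dist_comm, hadj])
    obtain h | h | h : G.dist u x = G.dist u w + 1 ∨ G.dist u w = G.dist u x + 1 ∨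
        G.dist u x = G.dist u w := by omega
    · simp [h, radialDrop_succ, add_assoc]
    · simp [h, radialDrop_succ, add_assoc]
    · simp [h]
  have hcard : ∀ j, ((Finset.univ.filter fun x => G.Adj w x).filter fun x => G.dist u x = j).card =
      intersectionNumber G (G.dist u w) j := by
    intro j
    rw [SimpleGraph.dist_comm, ← distCount_one_eq hG hR, distCount, Finset.filter_filter]
    simp only [SimpleGraph.dist_eq_one_iff_adj]
  rw [Finset.sum_congr rfl hterm, Finset.sum_sub_distrib, ← Finset.sum_filter, ← Finset.sum_filter,
    Finset.sum_const, Finset.sum_const, nsmul_eq_mul, nsmul_eq_mul, hcard,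
    up_mul_radialCurrent hG hR]
  rcases hd : G.dist u w with _ | d
  · have hwu : w = u := (hG.dist_eq_zero_iff.1 hd).symm
    simp [hopCount_zero hG hR, tailCount_zero hG hR, hwu]
    field_simp
  · have hwu : w ≠ u := by
      rintro rfl
      simp at hd
    have hdD : d < G.diam := by
      have := dist_le_diam hG u w
      omega
    have hk : (0 : ℝ) < hopCount G (d + 1) := Nat.cast_pos.2 ((hopCount_pos_iff hG hR).2 hdD)
    simp only [Nat.add_right_cancel_iff, Nat.add_sub_cancel, hwu, if_false]
    rw [hcard, hd, down_mul_radialCurrent hG hR hdD, tailCount_succ]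
    field_simp
    ring

/-- Superposition: the uniform sinks of the flows from `u` and from `v` cancel, and each flow
contributes one drop, whence the factor 2. -/
theorem resistanceDist_eq_radialDrop (hG : G.Connected) (hR : IsDistanceRegular G) (u v : V) :
    resistanceDist G u v = ENNReal.ofReal (2 * radialDrop G (G.dist u v)) := by
  have hφ : IsUnitCurrentPotential G u v fun w =>
      radialDrop G (G.dist v w) - radialDrop G (G.dist u w) := by
    intro w
    have h1 := sum_radialDrop_sub hG hR u w
    have h2 := sum_radialDrop_sub hG hR v w
    rw [← sub_sub_sub_cancel_right _ _ (1 / (Fintype.card V : ℝ)), ← h1, ← h2,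
      ← Finset.sum_sub_distrib]
    exact Finset.sum_congr rfl fun x _ => by ring
  rw [resistanceDist_eq hG hφ]
  congr 1
  simp only [SimpleGraph.dist_self, SimpleGraph.dist_comm (u := v) (v := u), radialDrop,
    Finset.range_zero, Finset.sum_empty]
  ring

theorem strictMonoOn_resistance (hG : G.Connected) (hR : IsDistanceRegular G) :
    StrictMonoOn (fun i => ENNReal.ofReal (2 * radialDrop G i)) (Set.Iic G.diam) := by
  have hmono : ∀ j, j ≤ G.diam → ∀ i < j, radialDrop G i < radialDrop G j := by
    intro j hj i hij
    rw [radialDrop, radialDrop, ← Finset.sum_range_add_sum_Ico _ hij.le, lt_add_iff_pos_right]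
    refine Finset.sum_pos (fun m hm => radialCurrent_pos hG hR ?_) (by simpa using hij)
    have := (Finset.mem_Ico.1 hm).2
    omega
  intro i _ j hj hij
  have h0 : 0 < radialDrop G j := by
    simpa [radialDrop] using hmono j hj 0 (by omega)
  exact (ENNReal.ofReal_lt_ofReal_iff (by linarith)).2 (by linarith [hmono j hj i hij])

theorem eq_of_strictMonoOn_image_eq {α : Type*} [LinearOrder α] {f g : ℕ → α} {m n : ℕ}
    (hf : StrictMonoOn f (Set.Iic m)) (hg : StrictMonoOn g (Set.Iic n))
    (h : f '' Set.Iic m = g '' Set.Iic n) : m = n ∧ ∀ i ≤ m, f i = g i := by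
  have hcard := congrArg Set.ncard h
  rw [hf.injOn.ncard_image, hg.injOn.ncard_image] at hcard
  have hmn : m = n := by simpa [Set.ncard_eq_toFinset_card'] using hcard
  subst hmn
  refine ⟨rfl, fun i => ?_⟩
  induction i using Nat.strong_induction_on with
  | _ i ih =>
  intro hi
  -- Write `f i = g j`. If `j < i`, then `g j = f j` by induction, against injectivity of `f`; so `i
  -- ≤ j`.
  have aux : ∀ {f g : ℕ → α}, StrictMonoOn f (Set.Iic m) → StrictMonoOn g (Set.Iic m) →
      f '' Set.Iic m = g '' Set.Iic m → (∀ j < i, j ≤ m → f j = g j) → g i ≤ f i := by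
    intro f g hf hg h ih
    obtain ⟨j, hj, hji⟩ : f i ∈ g '' Set.Iic m := h ▸ ⟨i, hi, rfl⟩
    rw [← hji]
    refine hg.monotoneOn hi hj ?_
    by_contra hlt
    rw [not_le] at hlt
    rw [← ih j hlt hj] at hji
    exact hlt.ne (hf.injOn hj hi hji)
  exact le_antisymm (aux hg hf h.symm fun j hj hm => (ih j hj hm).symm) (aux hf hg h ih)

/-- Monotonicity matches the resistance values of the two graphs distance by distance;
multiplicities give the hop counts and increments the edge currents. -/
theorem intersectionArray_eq_of_map_resistanceDist_eq (hG : G.Connected)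
    (hGR : IsDistanceRegular G) (hH : H.Connected) (hHR : IsDistanceRegular H) {v : V} {w : W}
    (h : Finset.univ.val.map (resistanceDist G v) = Finset.univ.val.map (resistanceDist H w)) :
    intersectionArray G = intersectionArray H := by
  classical
  have hn : Fintype.card V = Fintype.card W := by simpa using congrArg Multiset.card h
  rw [funext (resistanceDist_eq_radialDrop hG hGR v),
    funext (resistanceDist_eq_radialDrop hH hHR w)] at h
  have hGm := strictMonoOn_resistance hG hGR
  have hHm := strictMonoOn_resistance hH hHR
  set f := fun i => ENNReal.ofReal (2 * radialDrop G i) with hf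
  set g := fun i => ENNReal.ofReal (2 * radialDrop H i) with hg
  have himage : f '' Set.Iic G.diam = g '' Set.Iic H.diam := by
    have hset : ∀ r, r ∈ Finset.univ.val.map (fun x => f (G.dist v x)) ↔
        r ∈ Finset.univ.val.map (fun x => g (H.dist w x)) := fun r => by
      rw [show (Finset.univ.val.map (fun x => f (G.dist v x))) =
        Finset.univ.val.map (fun x => g (H.dist w x)) from h]
    simp only [Multiset.mem_map, Finset.mem_val, Finset.mem_univ, true_and] at hset
    ext r
    constructor
    · rintro ⟨i, hi, rfl⟩
      obtain ⟨x, hx⟩ := exists_dist_eq_from hG hGR hi v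
      obtain ⟨y, hy⟩ := (hset (f i)).1 ⟨x, by rw [hx]⟩
      exact ⟨_, dist_le_diam hH w y, hy⟩
    · rintro ⟨i, hi, rfl⟩
      obtain ⟨x, hx⟩ := exists_dist_eq_from hH hHR hi w
      obtain ⟨y, hy⟩ := (hset (g i)).2 ⟨x, by rw [hx]⟩
      exact ⟨_, dist_le_diam hG v y, hy⟩
  obtain ⟨hD, hfg⟩ := eq_of_strictMonoOn_image_eq hGm hHm himage
  have hk : ∀ i ≤ G.diam, hopCount G i = hopCount H i := by
    intro i hi
    rw [← count_map_comp_dist hG hGR (F := f) (fun n hn e => hGm.injOn hi hn e) v,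
      ← count_map_comp_dist hH hHR (F := g)
        (fun n hn e => hHm.injOn (show i ≤ H.diam from hD ▸ hi) hn e) w, hfg i hi]
    exact congrArg _ h
  have hdrop : ∀ i ≤ G.diam, radialDrop G i = radialDrop H i := by
    intro i hi
    have nn : ∀ j ≤ G.diam, 0 ≤ radialDrop G j := fun j hj => Finset.sum_nonneg fun m hm =>
      (radialCurrent_pos hG hGR ((Finset.mem_range.1 hm).trans_le hj)).le
    have nn' : ∀ j ≤ H.diam, 0 ≤ radialDrop H j := fun j hj => Finset.sum_nonneg fun m hm =>
      (radialCurrent_pos hH hHR ((Finset.mem_range.1 hm).trans_le hj)).le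
    have := (ENNReal.ofReal_eq_ofReal_iff (by linarith [nn i hi])
      (by linarith [nn' i (hD ▸ hi)])).1 (hfg i hi)
    linarith
  have hb : ∀ i < G.diam, intersectionNumber G i (i + 1) = intersectionNumber H i (i + 1) := by
    intro i hi
    have hcur : radialCurrent G i = radialCurrent H i := by
      have := hdrop (i + 1) hi
      rw [radialDrop_succ, radialDrop_succ, hdrop i hi.le] at this
      exact add_left_cancel this
    have htail : tailCount G i = tailCount H i := by
      rw [tailCount, tailCount, hn]
      congr 1
      refine Finset.sum_congr rfl fun j hj => ?_
      rw [hk j (by have := Finset.mem_range.1 hj; omega)]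
    -- All factors but the intersection number now agree, and the current is nonzero below the
    -- diameter.
    have hG1 := up_mul_radialCurrent hG hGR i
    rw [hcur, htail, hn, hk i hi.le, ← up_mul_radialCurrent hH hHR] at hG1
    exact_mod_cast mul_right_cancel₀ (hcur ▸ (radialCurrent_pos hG hGR hi).ne') hG1
  have hc : ∀ i < G.diam, intersectionNumber G (i + 1) i = intersectionNumber H (i + 1) i := by
    intro i hi
    have h1 := hopCount_mul_intersectionNumber hG hGR i (i + 1)
    rw [hk i hi.le, hb i hi, hopCount_mul_intersectionNumber hH hHR, hk (i + 1) hi] at h1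
    exact (Nat.eq_of_mul_eq_mul_left ((hopCount_pos_iff hH hHR).2 (hD ▸ hi)) h1).symm
  rw [intersectionArray, intersectionArray, ← hD]
  simp only [Prod.mk.injEq, List.map_inj_left, List.mem_range]
  exact ⟨hb, hc⟩

theorem rdwlDistinguishes_iff {hash : HashInput C → C} (hash_inj : Function.Injective hash)
    {c₀ : C} (hG : G.Connected) (hGR : IsDistanceRegular G) (hH : H.Connected)
    (hHR : IsDistanceRegular H) :
    RDWLDistinguishes hash c₀ G H ↔ intersectionArray G ≠ intersectionArray H := by
  have := hG.nonempty
  have := hH.nonempty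
  have forth : intersectionArray G = intersectionArray H →
      ∀ v w, Finset.univ.val.map (resistanceDist G v) =
        Finset.univ.val.map (resistanceDist H w) := by
    intro h v w
    rw [intersectionArray_eq_iff hG hGR hH hHR] at h
    have hk := hopCount_eq_of_intersectionNumber_eq hG hGR hH hHR h
    have hmap := map_dist_eq hG hGR hH hHR hk v w
    have hn : Fintype.card V = Fintype.card W := by simpa using congrArg Multiset.card hmap
    have hdrop : radialDrop G = radialDrop H := by
      funext i
      simp only [radialDrop, radialCurrent, tailCount, hk, h, hn]
    rw [funext (resistanceDist_eq_radialDrop hG hGR v),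
      funext (resistanceDist_eq_radialDrop hH hHR w), hdrop]
    simpa using congrArg (Multiset.map fun i => ENNReal.ofReal (2 * radialDrop H i)) hmap
  rw [RDWLDistinguishes, eventually_gdwlRepr_ne_iff hash_inj fun v w h =>
    forth (intersectionArray_eq_of_map_resistanceDist_eq hG hGR hH hHR h), not_iff_not]
  exact ⟨fun ⟨v, w, h⟩ => intersectionArray_eq_of_map_resistanceDist_eq hG hGR hH hHR h,
    fun h => ⟨_, _, forth h (Classical.arbitrary V) (Classical.arbitrary W)⟩⟩

end Resistance

/-! ### 2-FWL and the intersection array -/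

section FolkloreWL

variable {C : Type*} {V W : Type*} {G : SimpleGraph V} {H : SimpleGraph W}

theorem pairMatrix_eq_of_dist (hG : G.Connected) (nonedge edge node : C) (u v : V) :
    pairMatrix nonedge edge node G u v = Matrix.of fun i j =>
      if i = j then node else if G.dist u v = 0 then node
        else if G.dist u v = 1 then edge else nonedge := by
  by_cases huv : u = v
  · subst huv
    ext i j
    fin_cases i <;> fin_cases j <;> simp [pairMatrix]
  · have h0 : G.dist u v ≠ 0 := mt hG.dist_eq_zero_iff.1 huv
    by_cases hadj : G.Adj u v
    · ext i j
      fin_cases i <;> fin_cases j <;>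
        simp [pairMatrix, SimpleGraph.dist_eq_one_iff_adj.2 hadj, huv, Ne.symm huv, hadj, hadj.symm]
    · have h1 : G.dist u v ≠ 1 := mt SimpleGraph.dist_eq_one_iff_adj.1 hadj
      ext i j
      fin_cases i <;> fin_cases j <;>
        simp [pairMatrix, h0, h1, huv, Ne.symm huv, hadj, mt SimpleGraph.Adj.symm hadj]

theorem dist_iff_of_pairMatrix_eq (hG : G.Connected) (hH : H.Connected) {nonedge edge node : C}
    (h_nonedge_edge : nonedge ≠ edge) (h_nonedge_node : nonedge ≠ node) (h_edge_node : edge ≠ node)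
    {u v : V} {x y : W}
    (h : pairMatrix nonedge edge node G u v = pairMatrix nonedge edge node H x y)
    {k : ℕ} (hk : k ≤ 1) (huv : G.dist u v ≤ k) : H.dist x y ≤ k := by
  rw [pairMatrix_eq_of_dist hG, pairMatrix_eq_of_dist hH] at h
  have h01 := congrFun (congrFun h 0) 1
  simp only [Matrix.of_apply, zero_ne_one, if_false] at h01
  split_ifs at h01 <;> first | omega | simp_all

variable [Fintype V] [Fintype W]

/-- Each round extends by one the radius within which colours determine distance: the last edge of a
geodesic splits the pair into one at distance `T + 1` and one at distance 1, and a vertex `z` of the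
other graph has the same two colours. -/
theorem dist_le_of_fwlColor_eq {hash : HashInput C → C} (hash_inj : Function.Injective hash)
    (hG : G.Connected) (hH : H.Connected) {nonedge edge node : C}
    (h_nonedge_edge : nonedge ≠ edge) (h_nonedge_node : nonedge ≠ node) (h_edge_node : edge ≠ node)
    {T : ℕ} : ∀ {u v : V} {x y : W},
      fwlColor hash nonedge edge node G T u v = fwlColor hash nonedge edge node H T x y →
      ∀ {k : ℕ}, k ≤ T + 1 → G.dist u v ≤ k → H.dist x y ≤ k := by
  induction T with
  | zero =>
    intro u v x y h k hk huv
    exact dist_iff_of_pairMatrix_eq hG hH h_nonedge_edge h_nonedge_node h_edge_node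
      (HashInput.initial.inj (hash_inj h)) hk huv
  | succ T ih =>
    intro u v x y h k hk huv
    obtain ⟨h1, h2⟩ := HashInput.refine.inj (hash_inj h)
    by_cases hT : k ≤ T + 1
    · exact ih h1 hT huv
    obtain rfl : k = T + 1 + 1 := by omega
    rcases Nat.lt_or_ge (G.dist u v) (T + 1 + 1) with hlt | hge
    · exact (ih h1 le_rfl (Nat.le_of_lt_succ hlt)).trans (Nat.le_succ _)
    · obtain ⟨w, hadj, hw⟩ := exists_adj_dist_eq hG (le_antisymm huv hge)
      have hmem := Multiset.mem_map_of_mem (fun w => (fwlColor hash nonedge edge node G T w v,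
        fwlColor hash nonedge edge node G T u w)) (Finset.mem_univ_val w)
      rw [h2, Multiset.mem_map] at hmem
      obtain ⟨z, -, hz⟩ := hmem
      obtain ⟨hz1, hz2⟩ := Prod.mk.inj hz
      have d1 := ih hz1.symm (k := 1) (by omega) (SimpleGraph.dist_eq_one_iff_adj.2 hadj).le
      have d2 := ih hz2.symm le_rfl hw.le
      have := hH.dist_triangle (u := x) (v := z) (w := y)
      omega

theorem dist_eq_of_fwlColor_eq {hash : HashInput C → C} (hash_inj : Function.Injective hash)
    (hG : G.Connected) (hH : H.Connected) {nonedge edge node : C}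
    (h_nonedge_edge : nonedge ≠ edge) (h_nonedge_node : nonedge ≠ node) (h_edge_node : edge ≠ node)
    {T : ℕ} (hGT : G.diam ≤ T) (hHT : H.diam ≤ T) {u v : V} {x y : W}
    (h : fwlColor hash nonedge edge node G T u v = fwlColor hash nonedge edge node H T x y) :
    G.dist u v = H.dist x y := by
  have h1 := dist_le_diam hG u v
  have h2 := dist_le_diam hH x y
  exact le_antisymm
    (dist_le_of_fwlColor_eq hash_inj hH hG h_nonedge_edge h_nonedge_node h_edge_node h.symm
      (by omega) le_rfl)
    (dist_le_of_fwlColor_eq hash_inj hG hH h_nonedge_edge h_nonedge_node h_edge_node h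
      (by omega) le_rfl)

theorem distCount_eq_countP (G : SimpleGraph V) {δ : V → V → C} {P : ℕ → C → Prop}
    [∀ n c, Decidable (P n c)] (hP : ∀ n u v, P n (δ u v) ↔ G.dist u v = n) (i j : ℕ) (u v : V) :
    distCount G i j u v =
      (Finset.univ.val.map fun w => (δ w v, δ u w)).countP fun p => P i p.2 ∧ P j p.1 := by
  rw [Multiset.countP_map, distCount]
  simp only [Finset.card, Finset.filter_val, hP]
  simp_rw [SimpleGraph.dist_comm (G := G) (v := v)]

theorem distCount_eq_of_fwlColor_eq {hash : HashInput C → C} (hash_inj : Function.Injective hash)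
    (hG : G.Connected) (hH : H.Connected) {nonedge edge node : C}
    (h_nonedge_edge : nonedge ≠ edge) (h_nonedge_node : nonedge ≠ node) (h_edge_node : edge ≠ node)
    {T : ℕ} (hGT : G.diam ≤ T) (hHT : H.diam ≤ T) {u v : V} {x y : W}
    (h : fwlColor hash nonedge edge node G (T + 1) u v =
      fwlColor hash nonedge edge node H (T + 1) x y) (i j : ℕ) :
    distCount G i j u v = distCount H i j x y := by
  classical
  -- The colours that stand for distance `n` in either graph. A predicate common to both lets equal
  -- multisets of colours give equal counts.
  let P : ℕ → C → Prop := fun n c =>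
    (∃ a b, fwlColor hash nonedge edge node G T a b = c ∧ G.dist a b = n) ∨
      ∃ a b, fwlColor hash nonedge edge node H T a b = c ∧ H.dist a b = n
  have hPG : ∀ n a b, P n (fwlColor hash nonedge edge node G T a b) ↔ G.dist a b = n := by
    refine fun n a b => ⟨?_, fun hn => Or.inl ⟨a, b, rfl, hn⟩⟩
    rintro (⟨a', b', hc, rfl⟩ | ⟨a', b', hc, rfl⟩)
    · exact dist_eq_of_fwlColor_eq hash_inj hG hG h_nonedge_edge h_nonedge_node h_edge_node
        hGT hGT hc.symm
    · exact dist_eq_of_fwlColor_eq hash_inj hG hH h_nonedge_edge h_nonedge_node h_edge_node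
        hGT hHT hc.symm
  have hPH : ∀ n a b, P n (fwlColor hash nonedge edge node H T a b) ↔ H.dist a b = n := by
    refine fun n a b => ⟨?_, fun hn => Or.inr ⟨a, b, rfl, hn⟩⟩
    rintro (⟨a', b', hc, rfl⟩ | ⟨a', b', hc, rfl⟩)
    · exact dist_eq_of_fwlColor_eq hash_inj hH hG h_nonedge_edge h_nonedge_node h_edge_node
        hHT hGT hc.symm
    · exact dist_eq_of_fwlColor_eq hash_inj hH hH h_nonedge_edge h_nonedge_node h_edge_node
        hHT hHT hc.symm
  rw [distCount_eq_countP G hPG, distCount_eq_countP H hPH,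
    (HashInput.refine.inj (hash_inj h)).2]

theorem intersectionArray_eq_of_fwlRepr_eq {hash : HashInput C → C}
    (hash_inj : Function.Injective hash) (hG : G.Connected) (hGR : IsDistanceRegular G)
    (hH : H.Connected) (hHR : IsDistanceRegular H) {nonedge edge node : C}
    (h_nonedge_edge : nonedge ≠ edge) (h_nonedge_node : nonedge ≠ node) (h_edge_node : edge ≠ node)
    {T : ℕ} (hGT : G.diam ≤ T) (hHT : H.diam ≤ T)
    (h : fwlRepr hash nonedge edge node G (T + 1) = fwlRepr hash nonedge edge node H (T + 1)) :
    intersectionArray G = intersectionArray H := by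
  have hset : ∀ c, (∃ u v, fwlColor hash nonedge edge node G (T + 1) u v = c) ↔
      ∃ x y, fwlColor hash nonedge edge node H (T + 1) x y = c := by
    intro c
    have : c ∈ fwlRepr hash nonedge edge node G (T + 1) ↔
      c ∈ fwlRepr hash nonedge edge node H (T + 1) := by rw [h]
    simpa [fwlRepr, Multiset.mem_map] using this
  have hdist : ∀ {u v x y}, fwlColor hash nonedge edge node G (T + 1) u v =
      fwlColor hash nonedge edge node H (T + 1) x y → G.dist u v = H.dist x y :=
    dist_eq_of_fwlColor_eq hash_inj hG hH h_nonedge_edge h_nonedge_node h_edge_node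
      (hGT.trans (Nat.le_succ T)) (hHT.trans (Nat.le_succ T))
  rw [intersectionArray_eq_iff hG hGR hH hHR]
  intro i j
  by_cases hi : i ≤ G.diam
  · obtain ⟨u, v, rfl⟩ := exists_dist_eq hG hi
    obtain ⟨x, y, hxy⟩ := (hset _).1 ⟨u, v, rfl⟩
    rw [← distCount_one_eq hG hGR, hdist hxy.symm, ← distCount_one_eq hH hHR]
    exact distCount_eq_of_fwlColor_eq hash_inj hG hH h_nonedge_edge h_nonedge_node h_edge_node
      hGT hHT hxy.symm 1 j
  -- A distance occurring in `H` also occurs in `G`, through a shared colour.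
  · have hi' : ¬ i ≤ H.diam := by
      intro hi'
      obtain ⟨x, y, rfl⟩ := exists_dist_eq hH hi'
      obtain ⟨u, v, huv⟩ := (hset _).2 ⟨x, y, rfl⟩
      exact hi (hdist huv ▸ dist_le_diam hG u v)
    rw [intersectionNumber_eq_zero hG (Or.inl (not_le.1 hi)),
      intersectionNumber_eq_zero hH (Or.inl (not_le.1 hi'))]

theorem count_map_dist_pair (G : SimpleGraph V) (u v : V) (i j : ℕ) :
    (Finset.univ.val.map fun w => (G.dist w v, G.dist u w)).count (j, i) = distCount G i j u v := by
  rw [Multiset.count_map, distCount]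
  simp only [Finset.card, Finset.filter_val, Prod.mk.injEq]
  congr 1
  refine Multiset.filter_congr fun w _ => ?_
  rw [SimpleGraph.dist_comm (u := w), eq_comm (a := j), eq_comm (a := i), and_comm]

/-- The joint multiset of distances to a pair depends only on the distance of the pair, so
refinement preserves colours that are functions of distance. -/
theorem exists_fwlColor_eq_dist (hash : HashInput C → C) (hG : G.Connected)
    (hGR : IsDistanceRegular G) (hH : H.Connected) (hHR : IsDistanceRegular H)
    (nonedge edge node : C) (h : ∀ i j, intersectionNumber G i j = intersectionNumber H i j)
    (T : ℕ) : ∃ g : ℕ → C, (∀ u v, fwlColor hash nonedge edge node G T u v = g (G.dist u v)) ∧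
      ∀ x y, fwlColor hash nonedge edge node H T x y = g (H.dist x y) := by
  classical
  have hGq := distCount_one_eq hG hGR
  have hHq : ∀ x y j, distCount H 1 j x y = intersectionNumber G (H.dist x y) j := fun x y j => by
    rw [distCount_one_eq hH hHR, h]
  have hD := diam_eq_of_intersectionNumber_eq hG hGR hH hHR h
  obtain ⟨M, hMG, hMH⟩ : ∃ M : ℕ → Multiset (ℕ × ℕ),
      (∀ u v, Finset.univ.val.map (fun w => (G.dist w v, G.dist u w)) = M (G.dist u v)) ∧
        ∀ x y, Finset.univ.val.map (fun w => (H.dist w y, H.dist x w)) = M (H.dist x y) := by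
    -- The value 0 is for distances that do not occur.
    refine ⟨fun n => if hn : ∃ p : V × V, G.dist p.1 p.2 = n then
      Finset.univ.val.map fun w => (G.dist w hn.choose.2, G.dist hn.choose.1 w) else 0,
      fun u v => ?_, fun x y => ?_⟩
    · have hn : ∃ p : V × V, G.dist p.1 p.2 = G.dist u v := ⟨(u, v), rfl⟩
      simp only [dif_pos hn]
      ext ⟨j, i⟩
      rw [count_map_dist_pair, count_map_dist_pair]
      exact distCount_eq_of_local hG hG hGq hGq hn.choose_spec.symm i j
    · have hn : ∃ p : V × V, G.dist p.1 p.2 = H.dist x y := by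
        obtain ⟨u, v, huv⟩ := exists_dist_eq hG (hD ▸ dist_le_diam hH x y)
        exact ⟨(u, v), huv⟩
      simp only [dif_pos hn]
      ext ⟨j, i⟩
      rw [count_map_dist_pair, count_map_dist_pair]
      exact distCount_eq_of_local hH hG hHq hGq hn.choose_spec.symm i j
  induction T with
  | zero =>
    exact ⟨fun n => hash (.initial (Matrix.of fun i j =>
      if i = j then node else if n = 0 then node else if n = 1 then edge else nonedge)),
      fun u v => by rw [fwlColor, pairMatrix_eq_of_dist hG],
      fun x y => by rw [fwlColor, pairMatrix_eq_of_dist hH]⟩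
  | succ T ih =>
    obtain ⟨g, hgG, hgH⟩ := ih
    refine ⟨fun n => hash (.refine (g n) ((M n).map fun p => (g p.1, g p.2))),
      fun u v => ?_, fun x y => ?_⟩
    · simp [fwlColor, hgG, ← hMG]
    · simp [fwlColor, hgH, ← hMH]

theorem fwlRepr_eq_of_intersectionNumber_eq (hash : HashInput C → C) (hG : G.Connected)
    (hGR : IsDistanceRegular G) (hH : H.Connected) (hHR : IsDistanceRegular H)
    (nonedge edge node : C) (h : ∀ i j, intersectionNumber G i j = intersectionNumber H i j)
    (T : ℕ) : fwlRepr hash nonedge edge node G T = fwlRepr hash nonedge edge node H T := by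
  obtain ⟨g, hgG, hgH⟩ := exists_fwlColor_eq_dist hash hG hGR hH hHR nonedge edge node h T
  have hmap := map_dist_eq hG hGR hH hHR (hopCount_eq_of_intersectionNumber_eq hG hGR hH hHR h)
  have hn : Fintype.card V = Fintype.card W := by
    simpa using congrArg Multiset.card
      (hmap (Classical.choice hG.nonempty) (Classical.choice hH.nonempty))
  have hrepr : ∀ {M : Multiset C},
      (∀ u, Finset.univ.val.map (fwlColor hash nonedge edge node G T u) = M) →
      (∀ x, Finset.univ.val.map (fwlColor hash nonedge edge node H T x) = M) →
      fwlRepr hash nonedge edge node G T = fwlRepr hash nonedge edge node H T := by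
    intro M hM hM'
    -- Pairs are grouped by first vertex; every row is the same multiset.
    have eG : fwlRepr hash nonedge edge node G T = Finset.univ.val.bind fun u =>
        Finset.univ.val.map (fwlColor hash nonedge edge node G T u) := by
      refine (Multiset.map_bind _ _ _).trans ?_
      simp only [Multiset.map_map, Function.comp_def]
    have eH : fwlRepr hash nonedge edge node H T = Finset.univ.val.bind fun x =>
        Finset.univ.val.map (fwlColor hash nonedge edge node H T x) := by
      refine (Multiset.map_bind _ _ _).trans ?_
      simp only [Multiset.map_map, Function.comp_def]
    simp only [eG, eH, hM, hM', Multiset.bind, Multiset.map_const', Finset.card_val,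
      Finset.card_univ, hn]
  have x₀ := Classical.choice hH.nonempty
  have u₀ := Classical.choice hG.nonempty
  refine hrepr (M := (Finset.univ.val.map (H.dist x₀)).map g) (fun u => ?_) fun x => ?_
  · rw [← hmap u x₀]
    simp [hgG]
  · rw [← hmap u₀ x₀, hmap u₀ x]
    simp [hgH]

theorem fwlDistinguishes_iff {hash : HashInput C → C} (hash_inj : Function.Injective hash)
    {nonedge edge node : C} (h_nonedge_edge : nonedge ≠ edge) (h_nonedge_node : nonedge ≠ node)
    (h_edge_node : edge ≠ node) (hG : G.Connected) (hGR : IsDistanceRegular G)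
    (hH : H.Connected) (hHR : IsDistanceRegular H) :
    FWLDistinguishes hash nonedge edge node G H ↔ intersectionArray G ≠ intersectionArray H := by
  constructor
  · intro hne heq
    obtain ⟨T, hT⟩ := hne.exists
    exact hT (fwlRepr_eq_of_intersectionNumber_eq hash hG hGR hH hHR nonedge edge node
      ((intersectionArray_eq_iff hG hGR hH hHR).1 heq) T)
  · intro hne
    filter_upwards [eventually_ge_atTop (max G.diam H.diam + 1)] with T hT heq
    obtain ⟨T, rfl⟩ := Nat.exists_eq_succ_of_ne_zero (n := T) (by omega)
    exact hne (intersectionArray_eq_of_fwlRepr_eq hash_inj hG hGR hH hHR h_nonedge_edge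
      h_nonedge_node h_edge_node (by omega) (by omega) heq)

end FolkloreWL

/-! ### Two graphs with the same hop array and different intersection arrays -/

section Examples

/-- A certificate for distances: growth by at most one along edges bounds `d` above by walk lengths,
and stepwise descent builds walks of length `d`. On a finite graph the conditions are decidable. -/
theorem connected_and_dist_eq {V : Type*} [Nonempty V] {G : SimpleGraph V} {d : V → V → ℕ}
    (hself : ∀ u, d u u = 0) (hzero : ∀ u v, d u v = 0 → u = v)
    (hadj : ∀ u v w, G.Adj v w → d u v ≤ d u w + 1)
    (hstep : ∀ u v, d u v ≠ 0 → ∃ w, G.Adj w v ∧ d u w + 1 = d u v) :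
    G.Connected ∧ ∀ u v, G.dist u v = d u v := by
  have hwalk : ∀ (n : ℕ) (u v : V), d u v = n → ∃ p : G.Walk u v, p.length = n := by
    intro n
    induction n with
    | zero =>
      intro u v h
      obtain rfl := hzero u v h
      exact ⟨.nil, rfl⟩
    | succ n ih =>
      intro u v h
      obtain ⟨w, hw, hd⟩ := hstep u v (by omega)
      obtain ⟨p, hp⟩ := ih u w (by omega)
      exact ⟨p.concat hw, by simp [hp]⟩
  have hlower : ∀ (u v w : V) (p : G.Walk v w), d u v ≤ d u w + p.length := by
    intro u v w p
    induction p with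
    | nil => simp
    | cons h q ih =>
      have := hadj u _ _ h
      rw [SimpleGraph.Walk.length_cons]
      omega
  have hconn : G.Connected := (SimpleGraph.connected_iff _).2
    ⟨fun u v => ⟨(hwalk _ u v rfl).choose⟩, inferInstance⟩
  refine ⟨hconn, fun u v => le_antisymm ?_ ?_⟩
  · obtain ⟨p, hp⟩ := hwalk _ u v rfl
    exact hp ▸ SimpleGraph.dist_le p
  · obtain ⟨p, hp⟩ := hconn.exists_walk_length_eq_dist v u
    have := hlower u v u p
    rw [hself, hp, SimpleGraph.dist_comm] at this
    omega

theorem isDistanceRegular_of_local {V : Type*} [Fintype V] {G : SimpleGraph V}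
    (hG : G.Connected) {q : ℕ → ℕ → ℕ} (hq : ∀ u v j, distCount G 1 j u v = q (G.dist u v) j) :
    IsDistanceRegular G :=
  (isDistanceRegular_iff hG).2 fun i j _ _ _ _ h => distCount_eq_of_local hG hG hq hq h i j

/-- The double cover of the complete graph on `Fin 6` defined by the signing `s`: the vertices `a`
and `a + 6` lie over the same vertex. -/
def doubleCover (s : ℕ → ℕ → Bool) (hs : ∀ i j, s i j = s j i) : SimpleGraph (Fin 12) where
  Adj a b := a.val % 6 ≠ b.val % 6 ∧ s (a.val % 6) (b.val % 6) = (a.val / 6 == b.val / 6)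
  symm := ⟨fun a b h => ⟨h.1.symm, by rw [hs, h.2, Bool.beq_comm]⟩⟩
  loopless := ⟨fun a h => h.1 rfl⟩

instance (s : ℕ → ℕ → Bool) (hs : ∀ i j, s i j = s j i) : DecidableRel (doubleCover s hs).Adj :=
  fun _ _ => inferInstanceAs (Decidable (_ ∧ _))

/-- Distances in `doubleCover` when all pairs over distinct nonadjacent vertices have a common
neighbour and antipodal vertices have none. -/
def coverDist (s : ℕ → ℕ → Bool) (a b : Fin 12) : ℕ :=
  if a = b then 0
  else if a.val % 6 = b.val % 6 then 3
  else if s (a.val % 6) (b.val % 6) = (a.val / 6 == b.val / 6) then 1 else 2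

/-- The signing of the complete graph on six vertices whose double cover is the icosahedron. -/
def icosahedronSign (i j : ℕ) : Bool :=
  i == 5 || j == 5 || (i + 1) % 5 == j || (j + 1) % 5 == i

theorem icosahedronSign_comm (i j : ℕ) : icosahedronSign i j = icosahedronSign j i := by
  simp only [icosahedronSign]
  cases i == 5 <;> cases j == 5 <;> cases (i + 1) % 5 == j <;> cases (j + 1) % 5 == i <;> rfl

/-- The icosahedron. -/
def icosahedron : SimpleGraph (Fin 12) := doubleCover icosahedronSign icosahedronSign_comm

/-- The complete bipartite graph on two sets of six vertices, minus a perfect matching. -/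
def crown : SimpleGraph (Fin 12) := doubleCover (fun _ _ => false) fun _ _ => rfl

instance : DecidableRel icosahedron.Adj := inferInstanceAs (DecidableRel (doubleCover _ _).Adj)

instance : DecidableRel crown.Adj := inferInstanceAs (DecidableRel (doubleCover _ _).Adj)

/-- The intersection numbers of an antipodal double cover of the complete graph on six vertices
in which vertices at distance two have `μ` common neighbours. -/
def coverNumber (μ d j : ℕ) : ℕ :=
  (([[0, 5], [1, 4 - μ, μ], [0, μ, 4 - μ, 1], [0, 0, 5]] : List (List ℕ)).getD d []).getD j 0

theorem icosahedron_connected_and_dist :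
    icosahedron.Connected ∧ ∀ u v, icosahedron.dist u v = coverDist icosahedronSign u v :=
  connected_and_dist_eq (by decide +kernel) (by decide +kernel) (by decide +kernel)
    (by decide +kernel)

theorem crown_connected_and_dist :
    crown.Connected ∧ ∀ u v, crown.dist u v = coverDist (fun _ _ => false) u v :=
  connected_and_dist_eq (by decide +kernel) (by decide +kernel) (by decide +kernel)
    (by decide +kernel)

theorem coverDist_le (s : ℕ → ℕ → Bool) (a b : Fin 12) : coverDist s a b ≤ 3 := by
  unfold coverDist
  split_ifs <;> simp

theorem distCount_eq_coverNumber {G : SimpleGraph (Fin 12)} {s : ℕ → ℕ → Bool}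
    (hG : ∀ u v, G.dist u v = coverDist s u v) {μ : ℕ}
    (h : ∀ u v : Fin 12, ∀ j < 4, (Finset.univ.filter fun w =>
      coverDist s u w = 1 ∧ coverDist s v w = j).card = coverNumber μ (coverDist s u v) j)
    (u v : Fin 12) (j : ℕ) : distCount G 1 j u v = coverNumber μ (G.dist u v) j := by
  rcases Nat.lt_or_ge j 4 with hj | hj
  · simp only [distCount, hG, h u v j hj]
  · have hd := coverDist_le s u v
    have hz : coverNumber μ (coverDist s u v) j = 0 := by
      obtain ⟨k, rfl⟩ := Nat.exists_eq_add_of_le' hj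
      interval_cases coverDist s u v <;> simp [coverNumber]
    rw [distCount, hG, hz, Finset.card_eq_zero, Finset.filter_eq_empty_iff]
    intro w _ hw
    have := coverDist_le s v w
    rw [hG, hG] at hw
    omega

theorem icosahedron_distCount (u v : Fin 12) (j : ℕ) :
    distCount icosahedron 1 j u v = coverNumber 2 (icosahedron.dist u v) j :=
  distCount_eq_coverNumber icosahedron_connected_and_dist.2 (by decide +kernel) u v j

theorem crown_distCount (u v : Fin 12) (j : ℕ) :
    distCount crown 1 j u v = coverNumber 4 (crown.dist u v) j :=
  distCount_eq_coverNumber crown_connected_and_dist.2 (by decide +kernel) u v j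

theorem isDistanceRegular_icosahedron : IsDistanceRegular icosahedron :=
  isDistanceRegular_of_local icosahedron_connected_and_dist.1 icosahedron_distCount

theorem isDistanceRegular_crown : IsDistanceRegular crown :=
  isDistanceRegular_of_local crown_connected_and_dist.1 crown_distCount

theorem hopArray_icosahedron_eq_crown : hopArray icosahedron = hopArray crown := by
  obtain ⟨hG, hGd⟩ := icosahedron_connected_and_dist
  obtain ⟨hH, hHd⟩ := crown_connected_and_dist
  rw [hopArray_eq_iff hG isDistanceRegular_icosahedron hH isDistanceRegular_crown]
  intro i
  rw [← card_filter_dist_eq hG isDistanceRegular_icosahedron i 0,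
    ← card_filter_dist_eq hH isDistanceRegular_crown i 0]
  simp only [hGd, hHd]
  rcases Nat.lt_or_ge i 4 with hi | hi
  · revert i
    decide +kernel
  · have hz : ∀ s, (Finset.univ.filter fun w => coverDist s 0 w = i) = ∅ := by
      intro s
      rw [Finset.filter_eq_empty_iff]
      intro w _ hw
      have := coverDist_le s 0 w
      omega
    rw [hz, hz]

theorem intersectionArray_icosahedron_ne_crown :
    intersectionArray icosahedron ≠ intersectionArray crown := by
  obtain ⟨hG, hGd⟩ := icosahedron_connected_and_dist
  obtain ⟨hH, hHd⟩ := crown_connected_and_dist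
  rw [Ne, intersectionArray_eq_iff hG isDistanceRegular_icosahedron hH isDistanceRegular_crown]
  intro h
  -- Adjacent pairs: 0 and 5 lie on one sheet of the icosahedron, 0 and 7 on opposite sheets of the
  -- crown. They give `b_1 = 2` and `b_1 = 4`.
  have h1 := distCount_one_eq hG isDistanceRegular_icosahedron 0 5 2
  have h2 := distCount_one_eq hH isDistanceRegular_crown 0 7 2
  have e1 : coverDist icosahedronSign 0 5 = 1 := by decide
  have e2 : coverDist (fun _ _ => false) 0 7 = 1 := by decide
  rw [icosahedron_distCount, hGd, e1] at h1
  rw [crown_distCount, hHd, e2, ← h, ← h1] at h2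
  revert h2
  decide

theorem isEmpty_icosahedron_iso_crown : IsEmpty (icosahedron ≃g crown) := by
  refine ⟨fun e => ?_⟩
  -- The icosahedron has a triangle, while the crown is bipartite.
  have h1 : icosahedron.Adj 5 0 ∧ icosahedron.Adj 0 1 ∧ icosahedron.Adj 1 5 := by decide
  have h2 : ∀ a b c, ¬ (crown.Adj a b ∧ crown.Adj b c ∧ crown.Adj c a) := by decide +kernel
  exact h2 _ _ _ ⟨e.map_adj_iff.2 h1.1, e.map_adj_iff.2 h1.2.1, e.map_adj_iff.2 h1.2.2⟩

end Examples

end WLTest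

/-! ### The theorem -/

theorem theoremC {C : Type*} (hash : WLTest.HashInput C → C)
    (hash_inj : Function.Injective hash) (c₀ nonedge edge node : C)
    (h_nonedge_edge : nonedge ≠ edge) (h_nonedge_node : nonedge ≠ node)
    (h_edge_node : edge ≠ node) :
    (∀ (V : Type*) (W : Type*) [Fintype V] [Fintype W]
        (G : SimpleGraph V) (H : SimpleGraph W),
        G.Connected → WLTest.IsDistanceRegular G →
        H.Connected → WLTest.IsDistanceRegular H →
        (WLTest.SPDWLDistinguishes hash c₀ G H ↔ WLTest.hopArray G ≠ WLTest.hopArray H) ∧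
        (WLTest.RDWLDistinguishes hash c₀ G H ↔
          WLTest.intersectionArray G ≠ WLTest.intersectionArray H) ∧
        (WLTest.FWLDistinguishes hash nonedge edge node G H ↔
          WLTest.intersectionArray G ≠ WLTest.intersectionArray H) ∧
        (WLTest.SPDWLDistinguishes hash c₀ G H → WLTest.RDWLDistinguishes hash c₀ G H) ∧
        (WLTest.RDWLDistinguishes hash c₀ G H ↔
          WLTest.FWLDistinguishes hash nonedge edge node G H)) ∧
    (∃ (n m : ℕ) (G : SimpleGraph (Fin n)) (H : SimpleGraph (Fin m)),
        G.Connected ∧ WLTest.IsDistanceRegular G ∧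
        H.Connected ∧ WLTest.IsDistanceRegular H ∧
        IsEmpty (G ≃g H) ∧
        WLTest.RDWLDistinguishes hash c₀ G H ∧
        ¬ WLTest.SPDWLDistinguishes hash c₀ G H) := by
  refine ⟨fun V W _ _ G H hG hGR hH hHR => ?_, ?_⟩
  · have hS := WLTest.spdwlDistinguishes_iff hash_inj (c₀ := c₀) hG hGR hH hHR
    have hRD := WLTest.rdwlDistinguishes_iff hash_inj (c₀ := c₀) hG hGR hH hHR
    have hF := WLTest.fwlDistinguishes_iff hash_inj h_nonedge_edge h_nonedge_node h_edge_node
      hG hGR hH hHR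
    refine ⟨hS, hRD, hF, ?_, hRD.trans hF.symm⟩
    rw [hS, hRD]
    -- The intersection array determines the hop array.
    refine mt fun h => (WLTest.hopArray_eq_iff hG hGR hH hHR).2 ?_
    exact WLTest.hopCount_eq_of_intersectionNumber_eq hG hGR hH hHR
      ((WLTest.intersectionArray_eq_iff hG hGR hH hHR).1 h)
  · have hG := WLTest.icosahedron_connected_and_dist.1
    have hH := WLTest.crown_connected_and_dist.1
    have hGR := WLTest.isDistanceRegular_icosahedron
    have hHR := WLTest.isDistanceRegular_crown
    refine ⟨12, 12, WLTest.icosahedron, WLTest.crown, hG, hGR, hH, hHR,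
      WLTest.isEmpty_icosahedron_iso_crown, ?_, ?_⟩
    · exact (WLTest.rdwlDistinguishes_iff hash_inj hG hGR hH hHR).2
        WLTest.intersectionArray_icosahedron_ne_crown
    · rw [WLTest.spdwlDistinguishes_iff hash_inj hG hGR hH hHR]
      exact not_not.2 WLTest.hopArray_icosahedron_eq_crown
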